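/- Let $X\subset\mathbb R^d$ be a nonempty compact set (for instance the closure of a bounded connected open set with smooth boundary) and let $Y\subset\mathbb R^{d'}$ be compact. Let $\mathcal L$ be the Lebesgue measure on $X$, let $\mu$ be a probability measure on $X$ that is absolutely continuous with respect to $\mathcal L$ with density bounded from above, and let $\nu$ be an arbitrary Borel probability measure on $Y$. Let $V:X\times Y\to[0,\infty)$ be continuous (for instance of class $C^2$), and let $\kappa>0$ and $\tau>0$. Write $\Gamma(\mu,\nu)$ for the set of probability measures on $X\times Y$ with marginals $\mu$ and $\nu$. For probability measures $\alpha,\beta$ on $X$ let $\mathbf W(\alpha,\beta)^2=\inf_{\gamma\in\Gamma(\alpha,\beta)}\int|x-x'|^2\,d\gamma(x,x')$. For $\rho_1,\rho_2\in\mathcal P(X\times Y)$ with second marginal $\nu$ and disintegrations $(\rho_{1,y})_{y\in Y}$, $(\rho_{2,y})_{y\in Y}$ with respect to $\nu$, let $$\mathbf W_F(\rho_1,\rho_2)^2=\int_Y\mathbf W(\rho_{1,y},\rho_{2,y})^2\,d\nu(y).$$ Let $\mathcal H(\rho)=\int_{X\times Y}(r\log r-r+1)\,d\mathcal L\,d\nu$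 if $\rho$ has a density $r$ with respect to $\mathcal L\otimes\nu$, and $\mathcal H(\rho)=+\infty$ otherwise. For $\rho\in\mathcal P(X\times Y)$ let $$\mathcal E(\rho)=\int V\,d\rho+\kappa\,\mathcal H(\rho)\ \text{ if }\rho\in\Gamma(\mu,\nu),\qquad \mathcal E(\rho)=+\infty\ \text{ otherwise},$$ and, for $\bar\rho\in\Gamma(\mu,\nu)$, let $$\mathcal E_\tau(\rho\mid\bar\rho)=\frac1{2\tau}\mathbf W_F(\rho,\bar\rho)^2+\mathcal E(\rho)$$ (understood as $+\infty$ if $\rho\notin\Gamma(\mu,\nu)$). Then the following hold. (1) For every $\bar\rho\in\Gamma(\mu,\nu)$ the functional $\mathcal E_\tau(\cdot\mid\bar\rho)$ has a finite minimum over $\mathcal P(X\times Y)$, attained at exactly one $\rho$. This $\rho$ lies in $\Gamma(\mu,\nu)$, is absolutely continuous with respect to $\mathcal L\otimes\nu$, and its density $r$ satisfies $r>0$ $\mu\otimes\nu$-almost everywhere on $X\times Y$. (2) Consequently the minimizing movement scheme is well defined: for every $\rho^0\in\Gamma(\mu,\nu)$ there is exactly one sequence $(\rho^n)_{n\ge0}$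 in $\mathcal P(X\times Y)$ that starts at $\rho^0$ and for which $\rho^{n}$ minimizes $\mathcal E_\tau(\cdot\mid\rho^{n-1})$, with finite minimal value, for every $n\ge1$. For every $n\ge1$, $\rho^n$ is absolutely continuous with respect to $\mathcal L\otimes\nu$ and its density $r^n$ is positive $\mu\otimes\nu$-almost everywhere. -/

import Mathlib

open MeasureTheory ProbabilityTheory
open scoped ENNReal NNReal

noncomputable section

namespace FiberedJKO

/-- The Lebesgue measure `ℒ` on a compact set `X ⊆ ℝᵈ`. -/
def lebesgue {d : ℕ} (X : TopologicalSpace.NonemptyCompacts (EuclideanSpace ℝ (Fin d))) :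
    Measure X :=
  (volume : Measure (EuclideanSpace ℝ (Fin d))).comap Subtype.val

/-- `Γ(ρ₁, ρ₂)`: probability measures on `Z₁ × Z₂` with marginals `ρ₁` and `ρ₂`. -/
def couplings {Z₁ Z₂ : Type*} [MeasurableSpace Z₁] [MeasurableSpace Z₂]
    (ρ₁ : Measure Z₁) (ρ₂ : Measure Z₂) : Set (ProbabilityMeasure (Z₁ × Z₂)) :=
  {γ | (γ : Measure (Z₁ × Z₂)).map Prod.fst = ρ₁ ∧ (γ : Measure (Z₁ × Z₂)).map Prod.snd = ρ₂}

/-- `W(ρ₁, ρ₂)²`: the squared `L²` Wasserstein distance, i.e. the optimal transport cost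
for the cost `|x - x'|²`. -/
def wassersteinSq {X : Type*} [MeasurableSpace X] [MetricSpace X]
    (ρ₁ ρ₂ : Measure X) : ℝ≥0∞ :=
  ⨅ γ ∈ couplings ρ₁ ρ₂, ∫⁻ p, edist p.1 p.2 ^ 2 ∂(γ : Measure (X × X))

/-- The disintegration `(ρ_y)_{y ∈ Y}` of `ρ ∈ 𝒫(X × Y)` with respect to its second marginal:
`∫ ψ dρ = ∫_Y ∫_X ψ(x, y) dρ_y(x) d(P₂ρ)(y)`. -/
def disintegration {X Y : Type*} [MeasurableSpace X] [StandardBorelSpace X] [Nonempty X]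
    [MeasurableSpace Y] (ρ : ProbabilityMeasure (X × Y)) : Kernel Y X :=
  ((ρ : Measure (X × Y)).map Prod.swap).condKernel

/-- `W_F(ρ₁, ρ₂)² = ∫_Y W(ρ_{1,y}, ρ_{2,y})² dν(y)`: the squared fiber-wise Wasserstein distance
of two probability measures whose second marginal is `ν`. -/
def fiberWassersteinSq {X Y : Type*} [MetricSpace X] [MeasurableSpace X] [StandardBorelSpace X]
    [Nonempty X] [MeasurableSpace Y] (ν : Measure Y) (ρ₁ ρ₂ : ProbabilityMeasure (X × Y)) : ℝ≥0∞ :=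
  ∫⁻ y, wassersteinSq (disintegration ρ₁ y) (disintegration ρ₂ y) ∂ν

/-- The density `r` of `ρ` with respect to `ℒ ⊗ ν`. -/
def density {X Y : Type*} [MeasurableSpace X] [MeasurableSpace Y]
    (lam : Measure X) (ν : Measure Y) (ρ : ProbabilityMeasure (X × Y)) : X × Y → ℝ :=
  fun p => ((ρ : Measure (X × Y)).rnDeriv (lam.prod ν) p).toReal

open Classical in
/-- `H(ρ | ν) = ∫ (r log r - r + 1) dℒ dν` if `ρ ≪ ℒ ⊗ ν` has density `r`, and `+∞` otherwise.
The integrand is nonnegative. -/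
def entropy {X Y : Type*} [MeasurableSpace X] [MeasurableSpace Y]
    (lam : Measure X) (ν : Measure Y) (ρ : ProbabilityMeasure (X × Y)) : ℝ≥0∞ :=
  if (ρ : Measure (X × Y)) ≪ lam.prod ν then
    ∫⁻ p, ENNReal.ofReal (density lam ν ρ p * Real.log (density lam ν ρ p)
      - density lam ν ρ p + 1) ∂(lam.prod ν)
  else ⊤

open Classical in
/-- `E(ρ) = ∫ V dρ + κ H(ρ) + ι_{Γ(μ, ν)}(ρ)`, for a nonnegative potential `V`. -/
def energy {X Y : Type*} [MeasurableSpace X] [MeasurableSpace Y]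
    (lam μ : Measure X) (ν : Measure Y) (V : X × Y → ℝ) (κ : ℝ)
    (ρ : ProbabilityMeasure (X × Y)) : ℝ≥0∞ :=
  ∫⁻ p, ENNReal.ofReal (V p) ∂(ρ : Measure (X × Y)) + ENNReal.ofReal κ * entropy lam ν ρ
    + (if ρ ∈ couplings μ ν then 0 else ⊤)

/-- `E_τ(ρ | ρ̄) = W_F(ρ, ρ̄)² / (2τ) + E(ρ)`. -/
def stepEnergy {X Y : Type*} [MetricSpace X] [MeasurableSpace X] [StandardBorelSpace X]
    [Nonempty X] [MeasurableSpace Y] (lam μ : Measure X) (ν : Measure Y) (V : X × Y → ℝ)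
    (κ τ : ℝ) (ρbar ρ : ProbabilityMeasure (X × Y)) : ℝ≥0∞ :=
  ENNReal.ofReal (1 / (2 * τ)) * fiberWassersteinSq ν ρ ρbar + energy lam μ ν V κ ρ

/-- `ρ` minimizes `E_τ(· | ρ̄)` over `𝒫(X × Y)`, with a finite minimal value. -/
def IsStep {X Y : Type*} [MetricSpace X] [MeasurableSpace X] [StandardBorelSpace X]
    [Nonempty X] [MeasurableSpace Y] (lam μ : Measure X) (ν : Measure Y) (V : X × Y → ℝ)
    (κ τ : ℝ) (ρbar ρ : ProbabilityMeasure (X × Y)) : Prop :=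
  stepEnergy lam μ ν V κ τ ρbar ρ < ⊤ ∧
    ∀ ρ' : ProbabilityMeasure (X × Y),
      stepEnergy lam μ ν V κ τ ρbar ρ ≤ stepEnergy lam μ ν V κ τ ρbar ρ'

/-- `(ρⁿ)` is a trajectory of the minimizing movement scheme started at `ρ⁰`. -/
def IsScheme {X Y : Type*} [MetricSpace X] [MeasurableSpace X] [StandardBorelSpace X]
    [Nonempty X] [MeasurableSpace Y] (lam μ : Measure X) (ν : Measure Y) (V : X × Y → ℝ)
    (κ τ : ℝ) (ρ₀ : ProbabilityMeasure (X × Y)) (ρ : ℕ → ProbabilityMeasure (X × Y)) : Prop :=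
  ρ 0 = ρ₀ ∧ ∀ n, IsStep lam μ ν V κ τ (ρ n) (ρ (n + 1))

end FiberedJKO

end

open Filter Topology

open InformationTheory (klFun)

namespace FiberedJKO

/-! ### Transport cost: convexity and total-variation estimates. -/

section Wasserstein

variable {X : Type*} [MetricSpace X] [MeasurableSpace X]

/-! This is the direct method with strong `L¹` convergence in place of weak compactness. The
transport term is convex in `ρ` and the potential term is linear. The entropy has a quantified
convexity gap: `klFun_midpoint_add_le` bounds it below by Hellinger distance, hence by `L¹`
distance. Since the midpoint of two almost minimizers cannot go below the infimum, their densities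
are close in `L¹(ℒ ⊗ ν)` (`lintegral_density_sub_le`). This one estimate gives uniqueness and makes
minimizing sequences Cauchy.

The `L¹` limit keeps both marginals. Under `L¹` convergence of densities the transport and potential
terms are Lipschitz, because `X` has finite diameter and `V` is bounded
(`wassersteinSq_withDensity_le`, `lintegral_potential_le`). The entropy is lower semicontinuous by
Fatou, so the limit is a minimizer (`exists_isStep`). Integrating fibrewise convexity over `Y`
requires `y ↦ W²` to be measurable (`measurable_wassersteinSq_kernel`).

For positivity, mix the minimizer with a finite-energy competitor `π` at weight `t`. On the zero set
`A` of the density, the infinite slope of `r log r` at `0` gains `κ t |log t| π(A)`, against a cost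
of order `t`; letting `t → 0` forces `π(A) = 0`. The choice `π = μ ⊗ ν` has finite energy because
the density of `μ` is bounded. -/

theorem wassersteinSq_le_lintegral {α β : Measure X} (γ : Measure (X × X)) [IsProbabilityMeasure γ]
    (h₁ : γ.map Prod.fst = α) (h₂ : γ.map Prod.snd = β) :
    wassersteinSq α β ≤ ∫⁻ p, edist p.1 p.2 ^ 2 ∂γ :=
  iInf₂_le (⟨γ, inferInstance⟩ : ProbabilityMeasure (X × X)) ⟨h₁, h₂⟩

theorem wassersteinSq_le_of_edist_sq_le (α β : Measure X) [IsProbabilityMeasure α]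
    [IsProbabilityMeasure β] {C : ℝ≥0∞} (hC : ∀ x x' : X, edist x x' ^ 2 ≤ C) :
    wassersteinSq α β ≤ C := by
  refine (wassersteinSq_le_lintegral (α.prod β) (by simp) (by simp)).trans ?_
  calc ∫⁻ p, edist p.1 p.2 ^ 2 ∂(α.prod β) ≤ ∫⁻ _, C ∂(α.prod β) :=
        lintegral_mono fun p => hC p.1 p.2
    _ = C := by simp

theorem exists_coupling_lintegral_lt {α β : Measure X} {c : ℝ≥0∞} (h : wassersteinSq α β < c) :
    ∃ γ ∈ couplings α β, ∫⁻ p, edist p.1 p.2 ^ 2 ∂(γ : Measure (X × X)) < c := by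
  simpa only [wassersteinSq, iInf_lt_iff, exists_prop] using h

/-- The same mixture of two nearly optimal plans is a plan for the mixed first marginal, and its
cost is linear. -/
theorem wassersteinSq_mix_le {α₁ α₂ β : Measure X} {s t : ℝ≥0∞} (hst : s + t = 1) :
    wassersteinSq (s • α₁ + t • α₂) β ≤ s * wassersteinSq α₁ β + t * wassersteinSq α₂ β := by
  by_cases hs : s = 0
  · simp_all
  by_cases ht : t = 0
  · simp_all
  by_cases h1 : wassersteinSq α₁ β = ⊤
  · simp [h1, ENNReal.mul_top hs]
  by_cases h2 : wassersteinSq α₂ β = ⊤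
  · simp [h2, ENNReal.mul_top ht]
  refine ENNReal.le_of_forall_pos_le_add fun ε hε _ => ?_
  have hε' : (ε : ℝ≥0∞) ≠ 0 := by simpa using hε.ne'
  obtain ⟨γ₁, hγ₁, hc₁⟩ := exists_coupling_lintegral_lt (ENNReal.lt_add_right h1 hε')
  obtain ⟨γ₂, hγ₂, hc₂⟩ := exists_coupling_lintegral_lt (ENNReal.lt_add_right h2 hε')
  have hp : IsProbabilityMeasure (s • (γ₁ : Measure (X × X)) + t • (γ₂ : Measure (X × X))) :=
    ⟨by simp [hst]⟩
  have hβ : (s + t) • β = β := by rw [hst, one_smul]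
  refine (wassersteinSq_le_lintegral (s • (γ₁ : Measure (X × X)) + t • (γ₂ : Measure (X × X)))
    ?_ ?_).trans ?_
  · rw [Measure.map_add _ _ measurable_fst, Measure.map_smul, Measure.map_smul, hγ₁.1, hγ₂.1]
  · rw [Measure.map_add _ _ measurable_snd, Measure.map_smul, Measure.map_smul, hγ₁.2, hγ₂.2,
      ← add_smul, hβ]
  · rw [lintegral_add_measure, lintegral_smul_measure, lintegral_smul_measure]
    calc _ ≤ s * (wassersteinSq α₁ β + ε) + t * (wassersteinSq α₂ β + ε) := by
          simp only [smul_eq_mul]; gcongr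
      _ = s * wassersteinSq α₁ β + t * wassersteinSq α₂ β + (s + t) * ε := by ring
      _ = _ := by rw [hst, one_mul]

omit [MetricSpace X] in
theorem map_fst_withDensity_comp {γ : Measure (X × X)} {h : X → ℝ≥0∞} (hh : Measurable h) :
    (γ.withDensity fun p => h p.1).map Prod.fst = (γ.map Prod.fst).withDensity h := by
  ext A hA
  rw [Measure.map_apply measurable_fst hA, withDensity_apply _ (measurable_fst hA),
    withDensity_apply _ hA, setLIntegral_map hA hh measurable_fst]

/-- The transport cost is Lipschitz in the first measure with respect to the total variation. -/
theorem wassersteinSq_withDensity_le (lam : Measure X) [SFinite lam] {f g : X → ℝ≥0∞}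
    (hf : Measurable f) (hg : Measurable g) (β : Measure X)
    [IsProbabilityMeasure (lam.withDensity f)] [IsProbabilityMeasure (lam.withDensity g)]
    {C : ℝ≥0∞} (hC : ∀ x x' : X, edist x x' ^ 2 ≤ C) :
    wassersteinSq (lam.withDensity f) β ≤
      wassersteinSq (lam.withDensity g) β + C * ∫⁻ x, (f x - g x) ∂lam := by
  by_cases h1 : wassersteinSq (lam.withDensity g) β = ⊤
  · simp [h1]
  refine ENNReal.le_of_forall_pos_le_add fun ε hε _ => ?_
  have hε' : (ε : ℝ≥0∞) ≠ 0 := by simpa using hε.ne'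
  obtain ⟨γ, ⟨hγ₁, hγ₂⟩, hc⟩ := exists_coupling_lintegral_lt (ENNReal.lt_add_right h1 hε')
  set G : Measure (X × X) := (γ : Measure (X × X)) with hG
  have hgfin : ∀ᵐ x ∂lam, g x < ⊤ := by
    refine ae_lt_top hg ?_
    have : lam.withDensity g Set.univ = 1 := measure_univ
    rw [withDensity_apply _ MeasurableSet.univ, Measure.restrict_univ] at this
    simp [this]
  -- `h` is the fraction of the mass at `x` that is kept. `γ₁` is the kept part of a nearly optimal
  -- plan for `g`, with first marginal `min f g`; `γ₂` is the part removed.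
  set h : X → ℝ≥0∞ := fun x => min (f x) (g x) / g x with hhdef
  have hh : Measurable h := (hf.min hg).div hg
  have hh1 : ∀ x, h x ≤ 1 := fun x => ENNReal.div_le_of_le_mul (by simp)
  set γ₁ := G.withDensity fun p => h p.1 with hγ₁def
  set γ₂ := G.withDensity fun p => 1 - h p.1 with hγ₂def
  have hsum : γ₁ + γ₂ = G := by
    rw [hγ₁def, hγ₂def, ← withDensity_add_left (f := fun p : X × X => h p.1)
      (hh.comp measurable_fst)]
    have : ((fun p : X × X => h p.1) + fun p => 1 - h p.1) = 1 := by
      ext p; simp [hh1]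
    rw [this, withDensity_one]
  have hfst : γ₁.map Prod.fst = lam.withDensity fun x => min (f x) (g x) := by
    rw [hγ₁def, map_fst_withDensity_comp hh, hγ₁, ← withDensity_mul _ hg hh]
    refine withDensity_congr_ae ?_
    filter_upwards [hgfin] with x hx
    by_cases hx0 : g x = 0
    · simp [hx0]
    · simp only [Pi.mul_apply, hhdef]
      exact ENNReal.mul_div_cancel hx0 hx.ne
  set σ := lam.withDensity fun x => f x - g x with hσ
  have hfsum : (lam.withDensity fun x => min (f x) (g x)) + σ = lam.withDensity f := by
    rw [hσ, ← withDensity_add_left (hf.min hg)]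
    congr 1; ext x
    simp only [Pi.add_apply]
    rcases le_total (f x) (g x) with hle | hle
    · rw [min_eq_left hle, tsub_eq_zero_of_le hle, add_zero]
    · rw [min_eq_right hle, add_tsub_cancel_of_le hle]
  set δ := ∫⁻ x, (f x - g x) ∂lam with hδ
  have hσu : σ Set.univ = δ := by
    rw [hσ, withDensity_apply _ MeasurableSet.univ, Measure.restrict_univ]
  have hγ₁le : γ₁ Set.univ ≠ ⊤ := by
    refine ((Measure.le_add_right le_rfl : γ₁ ≤ γ₁ + γ₂) Set.univ).trans_lt ?_ |>.ne
    rw [hsum]; exact measure_lt_top _ _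
  -- Since `f` and `g` have equal mass, the mass removed equals the excess `(f - g)⁺`. The excess
  -- `σ` is then sent to the freed target `β₂` by the normalized product, at cost at most `C` per
  -- unit mass.
  have hγ₂u : γ₂ Set.univ = δ := by
    have e1 : γ₁ Set.univ + γ₂ Set.univ = 1 := by
      rw [← Measure.add_apply, hsum, hG]; exact measure_univ
    have e2 : γ₁ Set.univ + δ = 1 := by
      rw [← hσu, ← Set.preimage_univ (f := (Prod.fst : X × X → X)),
        ← Measure.map_apply measurable_fst MeasurableSet.univ, hfst, ← Measure.add_apply, hfsum]
      exact measure_univ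
    exact (ENNReal.add_right_inj hγ₁le).1 (e1.trans e2.symm)
  have hδtop : δ ≠ ⊤ := by
    rw [← hγ₂u]
    refine ((Measure.le_add_left le_rfl : γ₂ ≤ γ₁ + γ₂) Set.univ).trans_lt ?_ |>.ne
    rw [hsum]; exact measure_lt_top _ _
  set β₂ := γ₂.map Prod.snd with hβ₂
  have hβ₂u : β₂ Set.univ = δ := by
    rw [hβ₂, Measure.map_apply measurable_snd MeasurableSet.univ, Set.preimage_univ, hγ₂u]
  have : IsFiniteMeasure σ := ⟨by rw [hσu]; exact hδtop.lt_top⟩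
  have : IsFiniteMeasure β₂ := ⟨by rw [hβ₂u]; exact hδtop.lt_top⟩
  -- This includes `δ = 0`, where `δ⁻¹ = ∞` but `m` vanishes.
  have hcancel : ∀ m : Measure X, m Set.univ = δ → δ⁻¹ • δ • m = m := by
    intro m hm
    by_cases h0 : δ = 0
    · rw [h0, Measure.measure_univ_eq_zero] at hm
      simp [hm]
    · rw [smul_smul, ENNReal.inv_mul_cancel h0 hδtop, one_smul]
  have e1 : (γ₁ + δ⁻¹ • σ.prod β₂).map Prod.fst = lam.withDensity f := by
    rw [Measure.map_add _ _ measurable_fst, Measure.map_smul, Measure.map_fst_prod, hβ₂u,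
      hcancel σ hσu, hfst, hfsum]
  have e2 : (γ₁ + δ⁻¹ • σ.prod β₂).map Prod.snd = β := by
    rw [Measure.map_add _ _ measurable_snd, Measure.map_smul, Measure.map_snd_prod, hσu,
      hcancel β₂ hβ₂u, hβ₂, ← Measure.map_add _ _ measurable_snd, hsum, hγ₂]
  have hp : IsProbabilityMeasure (γ₁ + δ⁻¹ • σ.prod β₂) := by
    constructor
    rw [← Set.preimage_univ (f := (Prod.fst : X × X → X)),
        ← Measure.map_apply measurable_fst MeasurableSet.univ, e1]
    exact measure_univ
  refine (wassersteinSq_le_lintegral _ e1 e2).trans ?_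
  rw [lintegral_add_measure, lintegral_smul_measure]
  have c1 : ∫⁻ p, edist p.1 p.2 ^ 2 ∂γ₁ ≤ wassersteinSq (lam.withDensity g) β + ε := by
    refine (lintegral_mono' ?_ le_rfl).trans hc.le
    rw [← hsum]
    exact Measure.le_add_right le_rfl
  have c2 : δ⁻¹ • ∫⁻ p, edist p.1 p.2 ^ 2 ∂(σ.prod β₂) ≤ C * δ := by
    calc δ⁻¹ • ∫⁻ p, edist p.1 p.2 ^ 2 ∂(σ.prod β₂) ≤ δ⁻¹ • ∫⁻ _, C ∂(σ.prod β₂) := by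
          gcongr with p; exact hC _ _
      _ = δ⁻¹ * (C * (δ * δ)) := by
          rw [lintegral_const, ← Set.univ_prod_univ, Measure.prod_prod, hσu, hβ₂u, smul_eq_mul]
      _ = C * δ * (δ⁻¹ * δ) := by ring
      _ ≤ C * δ := mul_le_of_le_one_right' (ENNReal.inv_mul_le_one _)
  calc _ ≤ wassersteinSq (lam.withDensity g) β + ε + C * δ := add_le_add c1 c2
    _ = _ := by ring

end Wasserstein

/-! ### Measurable dependence of the transport cost on the fibre. -/

section Measurability

variable {X : Type*} [MetricSpace X] [CompactSpace X] [MeasurableSpace X] [BorelSpace X]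
  {Y : Type*} [MeasurableSpace Y]

/-- Integrals against a dense sequence in `C(X, ℝ)` embed probability measures into `ℕ → ℝ`. Plans
of cost at most `c` form a compact set, so their pairs of encoded marginals form a closed set. Its
preimage under `y ↦ (K y, L y)` is measurable, and no measurable selection of plans is needed. -/
theorem measurable_wassersteinSq_kernel (K L : Kernel Y X) [IsMarkovKernel K] [IsMarkovKernel L] :
    Measurable fun y => wassersteinSq (K y) (L y) := by
  obtain ⟨u, hu⟩ := TopologicalSpace.exists_dense_seq C(X, ℝ)
  let I : Measure X → ℕ → ℝ := fun α n => ∫ x, u n x ∂α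
  have hI : ∀ α β : ProbabilityMeasure X, I α = I β → α = β := by
    intro α β h
    refine Subtype.ext (ext_of_forall_integral_eq_of_IsFiniteMeasure (μ := (α : Measure X))
      (ν := (β : Measure X)) fun f => ?_)
    have hcont : ∀ α : ProbabilityMeasure X,
        Continuous fun f : C(X, ℝ) => ∫ x, f x ∂(α : Measure X) := by
      intro α
      refine (LipschitzWith.of_dist_le_mul (K := 1) fun f g => ?_).continuous
      have hint : ∀ f : C(X, ℝ), Integrable f (α : Measure X) := fun f =>
        f.continuous.integrable_of_hasCompactSupport (HasCompactSupport.of_compactSpace _)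
      rw [dist_eq_norm, dist_eq_norm, ← integral_sub (hint f) (hint g)]
      refine (norm_integral_le_of_norm_le_const (C := ‖f - g‖)
        (ae_of_all _ fun x => (f - g).norm_coe_le_norm x)).trans (by simp)
    exact congrFun ((hcont α).ext_on hu (hcont β) (by rintro _ ⟨n, rfl⟩; exact congrFun h n))
      f.toContinuousMap
  have hIc : Continuous fun α : ProbabilityMeasure X => I α := by
    refine continuous_pi fun n => ?_
    exact ProbabilityMeasure.continuous_integral_boundedContinuousFunction
      (BoundedContinuousFunction.mkOfCompact (u n))
  have hIm : ∀ K : Kernel Y X, [IsMarkovKernel K] → Measurable fun y => I (K y) := by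
    intro K _
    refine measurable_pi_lambda _ fun n => ?_
    exact ((u n).continuous.stronglyMeasurable.integral_kernel (κ := K)).measurable
  let S : ℝ≥0∞ → Set (ProbabilityMeasure (X × X)) := fun c =>
    {γ | ∫⁻ p, edist p.1 p.2 ^ 2 ∂(γ : Measure (X × X)) ≤ c}
  have hS : ∀ c, IsCompact (S c) := by
    intro c
    have hc : Continuous fun γ : ProbabilityMeasure (X × X) =>
        ∫⁻ p, edist p.1 p.2 ^ 2 ∂(γ : Measure (X × X)) := by
      have := ProbabilityMeasure.continuous_lintegral_continuousMap
        (⟨fun p => nndist p.1 p.2 ^ 2, by fun_prop⟩ : C(X × X, ℝ≥0))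
      have e : ∀ p : X × X, edist p.1 p.2 ^ 2 = ((nndist p.1 p.2 ^ 2 : ℝ≥0) : ℝ≥0∞) := fun p => by
        rw [edist_nndist, ENNReal.coe_pow]
      simp only [e]
      exact this
    exact (isClosed_le hc continuous_const).isCompact
  let J : ProbabilityMeasure (X × X) → (ℕ → ℝ) × (ℕ → ℝ) := fun γ =>
    (I ((γ : Measure (X × X)).map Prod.fst), I ((γ : Measure (X × X)).map Prod.snd))
  have hJ : Continuous J :=
    (hIc.comp (ProbabilityMeasure.continuous_map continuous_fst)).prodMk
      (hIc.comp (ProbabilityMeasure.continuous_map continuous_snd))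
  have hmeas : ∀ c, MeasurableSet {y | ∃ γ ∈ S c, J γ = (I (K y), I (L y))} := fun c =>
    ((hIm K).prodMk (hIm L)) (((hS c).image hJ).isClosed.measurableSet)
  have key : ∀ c y, (∃ γ ∈ S c, J γ = (I (K y), I (L y))) ↔
      ∃ γ ∈ couplings (K y) (L y), γ ∈ S c := by
    intro c y
    constructor
    · rintro ⟨γ, hγ, h⟩
      rw [Prod.mk.injEq] at h
      refine ⟨γ, ⟨?_, ?_⟩, hγ⟩
      · exact congrArg Subtype.val (hI (γ.map measurable_fst.aemeasurable)
          (⟨K y, inferInstance⟩ : ProbabilityMeasure X) h.1)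
      · exact congrArg Subtype.val (hI (γ.map measurable_snd.aemeasurable)
          (⟨L y, inferInstance⟩ : ProbabilityMeasure X) h.2)
    · rintro ⟨γ, ⟨h1, h2⟩, hγ⟩
      exact ⟨γ, hγ, by simp only [J, h1, h2]⟩
  refine measurable_of_Iio fun c => ?_
  -- Passing to thresholds `q < c` turns the strict inequality for an infimum into the existence of
  -- a plan of cost at most `q`.
  have : (fun y => wassersteinSq (K y) (L y)) ⁻¹' Set.Iio c =
      ⋃ q ∈ {q : ℚ | (Real.toNNReal q : ℝ≥0∞) < c},
        {y | ∃ γ ∈ S (Real.toNNReal q), J γ = (I (K y), I (L y))} := by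
    ext y
    simp only [Set.mem_preimage, Set.mem_Iio, Set.mem_iUnion, Set.mem_ofPred_eq, key]
    constructor
    · intro h
      obtain ⟨γ, hγ, hlt⟩ := exists_coupling_lintegral_lt h
      obtain ⟨q, -, hq1, hq2⟩ := ENNReal.lt_iff_exists_rat_btwn.1 hlt
      exact ⟨q, hq2, γ, hγ, hq1.le⟩
    · rintro ⟨q, hq, γ, hγ, hle⟩
      exact (iInf₂_le γ hγ).trans_lt (lt_of_le_of_lt hle hq)
  rw [this]
  exact MeasurableSet.biUnion (Set.to_countable _) fun q _ => hmeas _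

end Measurability

/-! ### Disintegrations of mixtures and of densities. -/

section Disintegration

variable {X Y : Type*} [MeasurableSpace X] [MeasurableSpace Y]

/-- The convex combination `s ρ₁ + t ρ₂` of two probability measures. -/
noncomputable def mix (s t : ℝ≥0∞) (hst : s + t = 1) (ρ₁ ρ₂ : ProbabilityMeasure (X × Y)) :
    ProbabilityMeasure (X × Y) :=
  ⟨s • (ρ₁ : Measure (X × Y)) + t • (ρ₂ : Measure (X × Y)), ⟨by simp [hst]⟩⟩

theorem coe_mix {s t : ℝ≥0∞} (hst : s + t = 1) (ρ₁ ρ₂ : ProbabilityMeasure (X × Y)) :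
    (mix s t hst ρ₁ ρ₂ : Measure (X × Y)) = s • (ρ₁ : Measure (X × Y)) + t • (ρ₂ : Measure _) :=
  rfl

theorem mix_mem_couplings {s t : ℝ≥0∞} (hst : s + t = 1) {μ : Measure X} {ν : Measure Y}
    {ρ₁ ρ₂ : ProbabilityMeasure (X × Y)} (h₁ : ρ₁ ∈ couplings μ ν) (h₂ : ρ₂ ∈ couplings μ ν) :
    mix s t hst ρ₁ ρ₂ ∈ couplings μ ν := by
  constructor
  · rw [coe_mix, Measure.map_add _ _ measurable_fst, Measure.map_smul, Measure.map_smul, h₁.1,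
      h₂.1, ← add_smul, hst, one_smul]
  · rw [coe_mix, Measure.map_add _ _ measurable_snd, Measure.map_smul, Measure.map_smul, h₁.2,
      h₂.2, ← add_smul, hst, one_smul]

variable [StandardBorelSpace X] [Nonempty X] {ν : Measure Y}

instance (ρ : ProbabilityMeasure (X × Y)) : IsMarkovKernel (disintegration ρ) :=
  inferInstanceAs (IsMarkovKernel ((ρ : Measure (X × Y)).map Prod.swap).condKernel)

theorem compProd_disintegration {ρ : ProbabilityMeasure (X × Y)}
    (h : (ρ : Measure (X × Y)).map Prod.snd = ν) :
    ν ⊗ₘ disintegration ρ = (ρ : Measure (X × Y)).map Prod.swap := by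
  have hfst : ((ρ : Measure (X × Y)).map Prod.swap).fst = ν := by
    rw [Measure.fst, Measure.map_map measurable_fst measurable_swap, ← h]; rfl
  have := Measure.disintegrate ((ρ : Measure (X × Y)).map Prod.swap)
    ((ρ : Measure (X × Y)).map Prod.swap).condKernel
  rwa [hfst] at this

/-- Disintegrations are unique `ν`-almost everywhere, and the mixed kernel recomposes to the mixed
measure. -/
theorem disintegration_mix [IsFiniteMeasure ν] {s t : ℝ≥0∞} (hst : s + t = 1)
    {ρ₁ ρ₂ : ProbabilityMeasure (X × Y)}
    (h₁ : (ρ₁ : Measure (X × Y)).map Prod.snd = ν) (h₂ : (ρ₂ : Measure (X × Y)).map Prod.snd = ν) :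
    ∀ᵐ y ∂ν, disintegration (mix s t hst ρ₁ ρ₂) y =
      s • disintegration ρ₁ y + t • disintegration ρ₂ y := by
  let K : Kernel Y X := ⟨fun y => s • disintegration ρ₁ y + t • disintegration ρ₂ y, by
    refine Measure.measurable_of_measurable_coe _ fun A hA => ?_
    simp only [Measure.add_apply, Measure.smul_apply, smul_eq_mul]
    exact ((Kernel.measurable_coe _ hA).const_mul s).add ((Kernel.measurable_coe _ hA).const_mul t)⟩
  have hKy : ∀ y, K y = s • disintegration ρ₁ y + t • disintegration ρ₂ y := fun y => rfl
  have : IsMarkovKernel K := ⟨fun y => ⟨by simp [hKy, hst]⟩⟩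
  have hm : (mix s t hst ρ₁ ρ₂ : Measure (X × Y)).map Prod.snd = ν := by
    rw [coe_mix, Measure.map_add _ _ measurable_snd, Measure.map_smul, Measure.map_smul, h₁,
      h₂, ← add_smul, hst, one_smul]
  refine Kernel.ae_eq_of_compProd_eq (η := K) ?_
  rw [compProd_disintegration hm, coe_mix, Measure.map_add _ _ measurable_swap, Measure.map_smul,
    Measure.map_smul, ← compProd_disintegration h₁, ← compProd_disintegration h₂]
  ext A hA
  have hmeas : ∀ ρ : ProbabilityMeasure (X × Y),
      Measurable fun y => disintegration ρ y (Prod.mk y ⁻¹' A) := fun ρ =>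
    Kernel.measurable_kernel_prodMk_left hA
  simp only [Measure.add_apply, Measure.smul_apply, smul_eq_mul, Measure.compProd_apply hA, hKy]
  rw [lintegral_add_left ((hmeas _).const_mul s), lintegral_const_mul _ (hmeas _),
    lintegral_const_mul _ (hmeas _)]

theorem disintegration_withDensity [IsFiniteMeasure ν] (lam : Measure X) [IsFiniteMeasure lam]
    {ρ : ProbabilityMeasure (X × Y)} (h : (ρ : Measure (X × Y)).map Prod.snd = ν)
    {f : X × Y → ℝ≥0∞} (hf : Measurable f)
    (hρ : (ρ : Measure (X × Y)) = (lam.prod ν).withDensity f) :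
    ∀ᵐ y ∂ν, disintegration ρ y = lam.withDensity fun x => f (x, y) := by
  have hI : Measurable fun y => ∫⁻ x, f (x, y) ∂lam := hf.lintegral_prod_left'
  have h1 : ∀ᵐ y ∂ν, ∫⁻ x, f (x, y) ∂lam = 1 := by
    refine (withDensity_eq_iff_of_sigmaFinite (g := 1) hI.aemeasurable aemeasurable_const).1 ?_
    rw [withDensity_one]
    ext B hB
    conv_rhs => rw [← h, hρ, Measure.map_apply measurable_snd hB,
      withDensity_apply _ (measurable_snd hB), ← Set.univ_prod, ← Measure.prod_restrict,
      Measure.restrict_univ, lintegral_prod_symm _ hf.aemeasurable]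
    rw [withDensity_apply _ hB]
  -- Fibres have mass `1` only almost everywhere. Cutting off outside `A` makes the candidate kernel
  -- finite at every point, as uniqueness of disintegrations requires.
  let A : Set Y := {y | ∫⁻ x, f (x, y) ∂lam ≤ 1}
  have hA : MeasurableSet A := measurableSet_le hI measurable_const
  let g : Y → X → ℝ≥0∞ := fun y x => A.indicator (fun y => f (x, y)) y
  have hg : Measurable (Function.uncurry g) :=
    (hf.comp measurable_swap).indicator (measurable_fst hA)
  let K : Kernel Y X := Kernel.withDensity (Kernel.const Y lam) g
  have hKy : ∀ y, K y = lam.withDensity (g y) := fun y => by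
    rw [Kernel.withDensity_apply _ hg, Kernel.const_apply]
  have hgA : ∀ y ∈ A, g y = fun x => f (x, y) := fun y hy => by
    ext x; exact Set.indicator_of_mem hy _
  have hK : IsFiniteKernel K := by
    refine ⟨1, ENNReal.one_lt_top, fun y => ?_⟩
    rw [hKy, withDensity_apply _ MeasurableSet.univ, Measure.restrict_univ]
    by_cases hy : y ∈ A
    · rw [hgA y hy]; exact hy
    · have : g y = 0 := by ext x; exact Set.indicator_of_notMem hy _
      simp [this]
  have hKae : ∀ᵐ y ∂ν, K y = lam.withDensity fun x => f (x, y) := by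
    filter_upwards [h1] with y hy
    rw [hKy, hgA y hy.le]
  have : disintegration ρ =ᵐ[ν] K := by
    refine Kernel.ae_eq_of_compProd_eq ?_
    rw [compProd_disintegration h, hρ]
    ext B hB
    rw [Measure.map_apply measurable_swap hB, withDensity_apply _ (measurable_swap hB),
      Measure.compProd_apply hB, ← lintegral_indicator (measurable_swap hB),
      lintegral_prod_symm _ (hf.indicator (measurable_swap hB)).aemeasurable]
    refine lintegral_congr_ae ?_
    filter_upwards [hKae] with y hy
    rw [hy, withDensity_apply _ (measurable_prodMk_left hB),
      ← lintegral_indicator (measurable_prodMk_left hB)]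
    rfl
  filter_upwards [this, hKae] with y h1 h2
  rw [h1, h2]

end Disintegration

/-! ### Fibrewise estimates integrated over `Y`. -/

section FiberWasserstein

variable {X Y : Type*} [MetricSpace X] [MeasurableSpace X] [StandardBorelSpace X] [Nonempty X]
  [MeasurableSpace Y] {ν : Measure Y} {C : ℝ≥0∞}

theorem fiberWassersteinSq_le [IsProbabilityMeasure ν] (hC : ∀ x x' : X, edist x x' ^ 2 ≤ C)
    (ρ₁ ρ₂ : ProbabilityMeasure (X × Y)) : fiberWassersteinSq ν ρ₁ ρ₂ ≤ C := by
  calc fiberWassersteinSq ν ρ₁ ρ₂ ≤ ∫⁻ _, C ∂ν :=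
        lintegral_mono fun y => wassersteinSq_le_of_edist_sq_le _ _ hC
    _ = C := by simp

theorem fiberWassersteinSq_mix_le [CompactSpace X] [BorelSpace X] [IsFiniteMeasure ν] {s t : ℝ≥0∞}
    (hst : s + t = 1) {ρ₁ ρ₂ : ProbabilityMeasure (X × Y)} (ρbar : ProbabilityMeasure (X × Y))
    (h₁ : (ρ₁ : Measure (X × Y)).map Prod.snd = ν) (h₂ : (ρ₂ : Measure (X × Y)).map Prod.snd = ν) :
    fiberWassersteinSq ν (mix s t hst ρ₁ ρ₂) ρbar ≤
      s * fiberWassersteinSq ν ρ₁ ρbar + t * fiberWassersteinSq ν ρ₂ ρbar := by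
  have hm : ∀ ρ : ProbabilityMeasure (X × Y), Measurable fun y =>
      wassersteinSq (disintegration ρ y) (disintegration ρbar y) := fun ρ =>
    measurable_wassersteinSq_kernel _ _
  simp only [fiberWassersteinSq]
  rw [← lintegral_const_mul _ (hm _), ← lintegral_const_mul _ (hm _),
    ← lintegral_add_left ((hm _).const_mul s)]
  refine lintegral_mono_ae ?_
  filter_upwards [disintegration_mix hst h₁ h₂] with y hy
  rw [hy]
  exact wassersteinSq_mix_le hst

theorem fiberWassersteinSq_withDensity_le [IsFiniteMeasure ν] (lam : Measure X)
    [IsFiniteMeasure lam] (hC : ∀ x x' : X, edist x x' ^ 2 ≤ C)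
    {ρ₁ ρ₂ : ProbabilityMeasure (X × Y)} (ρbar : ProbabilityMeasure (X × Y))
    (h₁ : (ρ₁ : Measure (X × Y)).map Prod.snd = ν) (h₂ : (ρ₂ : Measure (X × Y)).map Prod.snd = ν)
    {f₁ f₂ : X × Y → ℝ≥0∞} (hf₁ : Measurable f₁) (hf₂ : Measurable f₂)
    (hρ₁ : (ρ₁ : Measure (X × Y)) = (lam.prod ν).withDensity f₁)
    (hρ₂ : (ρ₂ : Measure (X × Y)) = (lam.prod ν).withDensity f₂) :
    fiberWassersteinSq ν ρ₁ ρbar ≤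
      fiberWassersteinSq ν ρ₂ ρbar + C * ∫⁻ p, (f₁ p - f₂ p) ∂(lam.prod ν) := by
  have hsub : Measurable fun p => f₁ p - f₂ p := hf₁.sub hf₂
  have hI : Measurable fun y => ∫⁻ x, (f₁ (x, y) - f₂ (x, y)) ∂lam := hsub.lintegral_prod_left'
  rw [lintegral_prod_symm _ hsub.aemeasurable, ← lintegral_const_mul _ hI]
  simp only [fiberWassersteinSq]
  rw [← lintegral_add_right _ (hI.const_mul C)]
  refine lintegral_mono_ae ?_
  filter_upwards [disintegration_withDensity lam h₁ hf₁ hρ₁,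
    disintegration_withDensity lam h₂ hf₂ hρ₂] with y h1 h2
  have i1 : IsProbabilityMeasure (lam.withDensity fun x => f₁ (x, y)) := by
    rw [← h1]; infer_instance
  have i2 : IsProbabilityMeasure (lam.withDensity fun x => f₂ (x, y)) := by
    rw [← h2]; infer_instance
  rw [h1, h2]
  exact wassersteinSq_withDensity_le lam (f := fun x => f₁ (x, y)) (g := fun x => f₂ (x, y))
    (hf₁.comp measurable_prodMk_right) (hf₂.comp measurable_prodMk_right) _ hC

end FiberWasserstein

/-! ### Scalar inequalities for `r log r - r + 1`. -/

section Scalar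

/-- This is `log u ≤ u - 1` at `u = √m / √a`. Summed over two points with midpoint `m`, it bounds
the convexity gap by a Hellinger distance. -/
theorem two_mul_sub_le_mul_log {a m : ℝ} (ha : 0 ≤ a) (hm : 0 < m) :
    2 * a - 2 * √a * √m ≤ a * Real.log a - a * Real.log m := by
  rcases ha.eq_or_lt with rfl | ha
  · simp
  have hsa : 0 < √a := Real.sqrt_pos.2 ha
  have hsm : 0 < √m := Real.sqrt_pos.2 hm
  have h1 := Real.log_le_sub_one_of_pos (div_pos hsm hsa)
  rw [Real.log_div hsm.ne' hsa.ne', Real.log_sqrt hm.le, Real.log_sqrt ha.le] at h1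
  have h2 := mul_le_mul_of_nonneg_left h1 ha.le
  have h3 : a * (√m / √a) = √a * √m := by
    conv_lhs => rw [← Real.mul_self_sqrt ha.le]
    field_simp
    rw [Real.sq_sqrt (by positivity)]
  nlinarith

/-- Quantitative midpoint convexity of `r log r - r + 1`. -/
theorem klFun_midpoint_add_le {a b : ℝ} (ha : 0 ≤ a) (hb : 0 ≤ b) (η : ℝ) :
    klFun (2⁻¹ * a + 2⁻¹ * b) + η / 2 * |a - b| ≤
      2⁻¹ * klFun a + 2⁻¹ * klFun b + η ^ 2 / 2 * (a + b) := by
  rcases (add_nonneg ha hb).eq_or_lt with h0 | hpos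
  · obtain rfl : a = 0 := by linarith
    obtain rfl : b = 0 := by linarith
    simp [klFun]; norm_num
  set m := 2⁻¹ * a + 2⁻¹ * b with hm
  have hm0 : 0 < m := by linarith
  have h1 := two_mul_sub_le_mul_log ha hm0
  have h2 := two_mul_sub_le_mul_log hb hm0
  have ea := Real.sq_sqrt ha
  have eb := Real.sq_sqrt hb
  have em := Real.sq_sqrt hm0.le
  have hx := Real.sqrt_nonneg a
  have hy := Real.sqrt_nonneg b
  set x := √a
  set y := √b
  set z := √m
  -- Factor `|a - b| = |√a - √b| (√a + √b)`, then apply Young's inequality with weight `η` and `(√a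
  -- + √b)² ≤ 2 (a + b)`.
  have h3 : η * |a - b| ≤ (x - y) ^ 2 / 2 + η ^ 2 * (a + b) := by
    have : |a - b| = |x - y| * (x + y) := by
      rw [← ea, ← eb, ← abs_of_nonneg (add_nonneg hx hy), ← abs_mul]
      congr 1; ring
    rw [this, ← ea, ← eb]
    nlinarith [sq_nonneg (|x - y| - η * (x + y)), sq_abs (x - y), sq_nonneg (η * (x - y))]
  have h4 : (x - y) ^ 2 / 2 ≤ 2 * a - 2 * x * z + (2 * b - 2 * y * z) := by
    nlinarith [sq_nonneg (x + y - 2 * z)]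
  have h5 : m * Real.log m = 2⁻¹ * (a * Real.log m) + 2⁻¹ * (b * Real.log m) := by
    rw [hm]; ring
  simp only [klFun]
  linarith

/-- The term `t |log t| p` is the exact gain over the chord from `0` to `p`; it is used where the
minimizer's density vanishes. -/
theorem klFun_mul_add {t p : ℝ} (ht : 0 < t) (hp : 0 ≤ p) :
    klFun (t * p) + t * -Real.log t * p = (1 - t) * klFun 0 + t * klFun p := by
  rcases hp.eq_or_lt with rfl | hp
  · simp only [mul_zero]
    ring
  · simp only [klFun, Real.log_mul ht.ne' hp.ne']
    simp
    ring

end Scalar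

/-! ### Densities and entropy under mixing. -/

section Density

variable {X Y : Type*} [MeasurableSpace X] [MeasurableSpace Y] {lam : Measure X} {ν : Measure Y}
  {ρ ρ₁ ρ₂ : ProbabilityMeasure (X × Y)}

theorem measurable_density (lam : Measure X) (ν : Measure Y) (ρ : ProbabilityMeasure (X × Y)) :
    Measurable (density lam ν ρ) :=
  (Measure.measurable_rnDeriv _ _).ennreal_toReal

theorem density_nonneg (lam : Measure X) (ν : Measure Y) (ρ : ProbabilityMeasure (X × Y))
    (p : X × Y) : 0 ≤ density lam ν ρ p :=
  ENNReal.toReal_nonneg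

theorem withDensity_density [IsFiniteMeasure lam] [IsFiniteMeasure ν]
    (h : (ρ : Measure (X × Y)) ≪ lam.prod ν) :
    (ρ : Measure (X × Y)) = (lam.prod ν).withDensity fun p => ENNReal.ofReal (density lam ν ρ p) := by
  conv_lhs => rw [← Measure.withDensity_rnDeriv_eq _ _ h]
  refine withDensity_congr_ae ?_
  filter_upwards [Measure.rnDeriv_lt_top (ρ : Measure (X × Y)) (lam.prod ν)] with p hp
  exact (ENNReal.ofReal_toReal hp.ne).symm

theorem lintegral_density [IsFiniteMeasure lam] [IsFiniteMeasure ν]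
    (h : (ρ : Measure (X × Y)) ≪ lam.prod ν) :
    ∫⁻ p, ENNReal.ofReal (density lam ν ρ p) ∂(lam.prod ν) = 1 := by
  rw [← setLIntegral_univ, ← withDensity_apply _ MeasurableSet.univ, ← withDensity_density h]
  exact measure_univ

theorem density_mix [IsFiniteMeasure lam] [IsFiniteMeasure ν] {s t : ℝ≥0∞} (hst : s + t = 1)
    (ρ₁ ρ₂ : ProbabilityMeasure (X × Y)) :
    ∀ᵐ p ∂(lam.prod ν), density lam ν (mix s t hst ρ₁ ρ₂) p =
      s.toReal * density lam ν ρ₁ p + t.toReal * density lam ν ρ₂ p := by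
  have hs : s ≠ ⊤ := ne_top_of_le_ne_top ENNReal.one_ne_top (hst ▸ le_self_add)
  have ht : t ≠ ⊤ := ne_top_of_le_ne_top ENNReal.one_ne_top (hst ▸ le_add_self)
  have : IsFiniteMeasure (s • (ρ₁ : Measure (X × Y))) := Measure.smul_finite _ hs
  have : IsFiniteMeasure (t • (ρ₂ : Measure (X × Y))) := Measure.smul_finite _ ht
  filter_upwards [Measure.rnDeriv_add (s • (ρ₁ : Measure (X × Y))) (t • (ρ₂ : Measure (X × Y)))
    (lam.prod ν), Measure.rnDeriv_smul_left_of_ne_top (ρ₁ : Measure (X × Y)) (lam.prod ν) hs,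
    Measure.rnDeriv_smul_left_of_ne_top (ρ₂ : Measure (X × Y)) (lam.prod ν) ht,
    Measure.rnDeriv_lt_top (ρ₁ : Measure (X × Y)) (lam.prod ν),
    Measure.rnDeriv_lt_top (ρ₂ : Measure (X × Y)) (lam.prod ν)] with p h0 h1 h2 f1 f2
  simp only [density, coe_mix]
  rw [h0, Pi.add_apply, h1, h2, Pi.smul_apply, Pi.smul_apply, smul_eq_mul, smul_eq_mul,
    ENNReal.toReal_add (ENNReal.mul_ne_top hs f1.ne) (ENNReal.mul_ne_top ht f2.ne),
    ENNReal.toReal_mul, ENNReal.toReal_mul]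

theorem mix_absolutelyContinuous {s t : ℝ≥0∞} (hst : s + t = 1) {M : Measure (X × Y)}
    (h₁ : (ρ₁ : Measure (X × Y)) ≪ M) (h₂ : (ρ₂ : Measure (X × Y)) ≪ M) :
    (mix s t hst ρ₁ ρ₂ : Measure (X × Y)) ≪ M :=
  fun A hA => by simp [coe_mix, h₁ hA, h₂ hA]

theorem entropy_eq_lintegral (h : (ρ : Measure (X × Y)) ≪ lam.prod ν) :
    entropy lam ν ρ = ∫⁻ p, ENNReal.ofReal (klFun (density lam ν ρ p)) ∂(lam.prod ν) := by
  rw [entropy, if_pos h]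
  refine lintegral_congr fun p => ?_
  rw [klFun]; congr 1; ring

theorem measurable_ofReal_klFun_density (lam : Measure X) (ν : Measure Y)
    (ρ : ProbabilityMeasure (X × Y)) :
    Measurable fun p => ENNReal.ofReal (klFun (density lam ν ρ p)) :=
  (InformationTheory.measurable_klFun.comp (measurable_density lam ν ρ)).ennreal_ofReal

/-- The gain `e` and error `e'` are left free so that one integration serves both the midpoint
estimate and the positivity argument. -/
theorem entropy_mix_add_le [IsFiniteMeasure lam] [IsFiniteMeasure ν] {s t : ℝ≥0∞}
    (hst : s + t = 1) (h₁ : (ρ₁ : Measure (X × Y)) ≪ lam.prod ν)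
    (h₂ : (ρ₂ : Measure (X × Y)) ≪ lam.prod ν) {e e' : X × Y → ℝ} (he : Measurable e)
    (he' : Measurable e') (he0 : ∀ p, 0 ≤ e p) (he'0 : ∀ p, 0 ≤ e' p)
    (h : ∀ p, klFun (s.toReal * density lam ν ρ₁ p + t.toReal * density lam ν ρ₂ p) + e p ≤
      s.toReal * klFun (density lam ν ρ₁ p) + t.toReal * klFun (density lam ν ρ₂ p) + e' p) :
    entropy lam ν (mix s t hst ρ₁ ρ₂) + ∫⁻ p, ENNReal.ofReal (e p) ∂(lam.prod ν) ≤
      s * entropy lam ν ρ₁ + t * entropy lam ν ρ₂ + ∫⁻ p, ENNReal.ofReal (e' p) ∂(lam.prod ν) := by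
  have hs : s ≠ ⊤ := ne_top_of_le_ne_top ENNReal.one_ne_top (hst ▸ le_self_add)
  have ht : t ≠ ⊤ := ne_top_of_le_ne_top ENNReal.one_ne_top (hst ▸ le_add_self)
  rw [entropy_eq_lintegral (mix_absolutelyContinuous hst h₁ h₂), entropy_eq_lintegral h₁,
    entropy_eq_lintegral h₂, ← lintegral_add_right _ he.ennreal_ofReal,
    ← lintegral_const_mul _ (measurable_ofReal_klFun_density _ _ _),
    ← lintegral_const_mul _ (measurable_ofReal_klFun_density _ _ _),
    ← lintegral_add_left ((measurable_ofReal_klFun_density _ _ _).const_mul _),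
    ← lintegral_add_right _ he'.ennreal_ofReal]
  refine lintegral_mono_ae ?_
  filter_upwards [density_mix (lam := lam) (ν := ν) hst ρ₁ ρ₂] with p hp
  have k1 := InformationTheory.klFun_nonneg (density_nonneg lam ν ρ₁ p)
  have k2 := InformationTheory.klFun_nonneg (density_nonneg lam ν ρ₂ p)
  have k3 := InformationTheory.klFun_nonneg (density_nonneg lam ν (mix s t hst ρ₁ ρ₂) p)
  have s0 : 0 ≤ s.toReal := ENNReal.toReal_nonneg
  have t0 : 0 ≤ t.toReal := ENNReal.toReal_nonneg
  rw [← ENNReal.ofReal_add k3 (he0 p)]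
  conv_rhs => rw [← ENNReal.ofReal_toReal hs, ← ENNReal.ofReal_toReal ht]
  rw [← ENNReal.ofReal_mul s0, ← ENNReal.ofReal_mul t0,
    ← ENNReal.ofReal_add (mul_nonneg s0 k1) (mul_nonneg t0 k2),
    ← ENNReal.ofReal_add (by positivity) (he'0 p), hp]
  exact ENNReal.ofReal_le_ofReal (h p)

end Density

/-! ### Convexity of the step functional; closeness of almost minimizers. -/

section StepEnergy

variable {X Y : Type*} [MetricSpace X] [MeasurableSpace X] [StandardBorelSpace X] [Nonempty X]
  [MeasurableSpace Y] {lam μ : Measure X} {ν : Measure Y} {V : X × Y → ℝ} {κ τ : ℝ}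
  {ρbar ρ ρ₁ ρ₂ : ProbabilityMeasure (X × Y)}

theorem mem_couplings_of_stepEnergy_lt_top (h : stepEnergy lam μ ν V κ τ ρbar ρ < ⊤) :
    ρ ∈ couplings μ ν := by
  by_contra hn
  simp [stepEnergy, energy, hn] at h

theorem absolutelyContinuous_of_stepEnergy_lt_top (hκ : 0 < κ)
    (h : stepEnergy lam μ ν V κ τ ρbar ρ < ⊤) : (ρ : Measure (X × Y)) ≪ lam.prod ν := by
  by_contra hn
  simp [stepEnergy, energy, entropy, hn, ENNReal.mul_top, hκ] at h

theorem stepEnergy_eq (h : ρ ∈ couplings μ ν) :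
    stepEnergy lam μ ν V κ τ ρbar ρ = (ENNReal.ofReal (1 / (2 * τ)) * fiberWassersteinSq ν ρ ρbar +
      ∫⁻ p, ENNReal.ofReal (V p) ∂(ρ : Measure (X × Y))) + ENNReal.ofReal κ * entropy lam ν ρ := by
  rw [stepEnergy, energy, if_pos h, add_zero, add_assoc]

variable [CompactSpace X] [BorelSpace X] [IsFiniteMeasure lam] [IsFiniteMeasure ν]

theorem stepEnergy_mix_add_le {s t : ℝ≥0∞}
    (hst : s + t = 1) (hc₁ : ρ₁ ∈ couplings μ ν) (hc₂ : ρ₂ ∈ couplings μ ν)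
    (h₁ : (ρ₁ : Measure (X × Y)) ≪ lam.prod ν)
    (h₂ : (ρ₂ : Measure (X × Y)) ≪ lam.prod ν) {e e' : X × Y → ℝ} (he : Measurable e)
    (he' : Measurable e') (he0 : ∀ p, 0 ≤ e p) (he'0 : ∀ p, 0 ≤ e' p)
    (h : ∀ p, klFun (s.toReal * density lam ν ρ₁ p + t.toReal * density lam ν ρ₂ p) + e p ≤
      s.toReal * klFun (density lam ν ρ₁ p) + t.toReal * klFun (density lam ν ρ₂ p) + e' p) :
    stepEnergy lam μ ν V κ τ ρbar (mix s t hst ρ₁ ρ₂) +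
        ENNReal.ofReal κ * ∫⁻ p, ENNReal.ofReal (e p) ∂(lam.prod ν) ≤
      s * stepEnergy lam μ ν V κ τ ρbar ρ₁ + t * stepEnergy lam μ ν V κ τ ρbar ρ₂ +
        ENNReal.ofReal κ * ∫⁻ p, ENNReal.ofReal (e' p) ∂(lam.prod ν) := by
  rw [stepEnergy_eq (mix_mem_couplings hst hc₁ hc₂), stepEnergy_eq hc₁, stepEnergy_eq hc₂]
  have H := entropy_mix_add_le hst h₁ h₂ he he' he0 he'0 h
  have W := fiberWassersteinSq_mix_le hst ρbar hc₁.2 hc₂.2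
  rw [coe_mix, lintegral_add_measure, lintegral_smul_measure, lintegral_smul_measure]
  set c := ENNReal.ofReal (1 / (2 * τ))
  set k := ENNReal.ofReal κ
  simp only [smul_eq_mul]
  calc _ = c * fiberWassersteinSq ν (mix s t hst ρ₁ ρ₂) ρbar +
        (s * ∫⁻ p, ENNReal.ofReal (V p) ∂(ρ₁ : Measure (X × Y)) +
          t * ∫⁻ p, ENNReal.ofReal (V p) ∂(ρ₂ : Measure (X × Y))) +
        k * (entropy lam ν (mix s t hst ρ₁ ρ₂) + ∫⁻ p, ENNReal.ofReal (e p) ∂(lam.prod ν)) := by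
        ring
    _ ≤ c * (s * fiberWassersteinSq ν ρ₁ ρbar + t * fiberWassersteinSq ν ρ₂ ρbar) +
        (s * ∫⁻ p, ENNReal.ofReal (V p) ∂(ρ₁ : Measure (X × Y)) +
          t * ∫⁻ p, ENNReal.ofReal (V p) ∂(ρ₂ : Measure (X × Y))) +
        k * (s * entropy lam ν ρ₁ + t * entropy lam ν ρ₂ +
          ∫⁻ p, ENNReal.ofReal (e' p) ∂(lam.prod ν)) := by
        gcongr
    _ = _ := by ring

/-- The midpoint has energy at least `I`, so the convexity gain `κ (η / 2) ‖r₁ - r₂‖₁` is at most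
the excess `κ η²` plus the error term. The latter is also `κ η²`, both densities having mass `1`. -/
theorem lintegral_density_sub_le (hκ : 0 < κ) {I : ℝ≥0∞} (hI : I ≠ ⊤)
    (hmin : ∀ ρ : ProbabilityMeasure (X × Y), I ≤ stepEnergy lam μ ν V κ τ ρbar ρ) {η : ℝ}
    (hη : 0 < η) (h₁ : stepEnergy lam μ ν V κ τ ρbar ρ₁ ≤ I + ENNReal.ofReal (κ * η ^ 2))
    (h₂ : stepEnergy lam μ ν V κ τ ρbar ρ₂ ≤ I + ENNReal.ofReal (κ * η ^ 2)) :
    ∫⁻ p, ‖density lam ν ρ₁ p - density lam ν ρ₂ p‖ₑ ∂(lam.prod ν) ≤ ENNReal.ofReal (4 * η) := by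
  have htop : I + ENNReal.ofReal (κ * η ^ 2) < ⊤ :=
    ENNReal.add_lt_top.2 ⟨hI.lt_top, ENNReal.ofReal_lt_top⟩
  have f1 := h₁.trans_lt htop
  have f2 := h₂.trans_lt htop
  have c1 := mem_couplings_of_stepEnergy_lt_top f1
  have c2 := mem_couplings_of_stepEnergy_lt_top f2
  have a1 := absolutelyContinuous_of_stepEnergy_lt_top hκ f1
  have a2 := absolutelyContinuous_of_stepEnergy_lt_top hκ f2
  have m1 := measurable_density lam ν ρ₁
  have m2 := measurable_density lam ν ρ₂
  have n1 := density_nonneg lam ν ρ₁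
  have n2 := density_nonneg lam ν ρ₂
  have key := stepEnergy_mix_add_le (V := V) (κ := κ) (τ := τ) (ρbar := ρbar)
    (s := 2⁻¹) (t := 2⁻¹) ENNReal.inv_two_add_inv_two c1 c2 a1 a2
    (e := fun p => η / 2 * |density lam ν ρ₁ p - density lam ν ρ₂ p|)
    (e' := fun p => η ^ 2 / 2 * (density lam ν ρ₁ p + density lam ν ρ₂ p))
    (by fun_prop) (by fun_prop) (fun p => by positivity)
    (fun p => mul_nonneg (by positivity) (add_nonneg (n1 p) (n2 p)))
    (fun p => by simpa using klFun_midpoint_add_le (n1 p) (n2 p) η)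
  have i1 : ∫⁻ p, ENNReal.ofReal (η ^ 2 / 2 * (density lam ν ρ₁ p + density lam ν ρ₂ p))
      ∂(lam.prod ν) = ENNReal.ofReal (η ^ 2) := by
    have : ∀ p, ENNReal.ofReal (η ^ 2 / 2 * (density lam ν ρ₁ p + density lam ν ρ₂ p)) =
        ENNReal.ofReal (η ^ 2 / 2) * (ENNReal.ofReal (density lam ν ρ₁ p) +
          ENNReal.ofReal (density lam ν ρ₂ p)) := fun p => by
      rw [ENNReal.ofReal_mul (by positivity), ENNReal.ofReal_add (n1 p) (n2 p)]
    simp only [this]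
    rw [lintegral_const_mul _ (by fun_prop),
      lintegral_add_left m1.ennreal_ofReal, lintegral_density a1, lintegral_density a2,
      ← ENNReal.ofReal_one, ← ENNReal.ofReal_add zero_le_one zero_le_one,
      ← ENNReal.ofReal_mul (by positivity)]
    congr 1; ring
  have i2 : ∫⁻ p, ENNReal.ofReal (η / 2 * |density lam ν ρ₁ p - density lam ν ρ₂ p|)
      ∂(lam.prod ν) = ENNReal.ofReal (η / 2) *
        ∫⁻ p, ‖density lam ν ρ₁ p - density lam ν ρ₂ p‖ₑ ∂(lam.prod ν) := by
    rw [← lintegral_const_mul _ (by fun_prop)]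
    refine lintegral_congr fun p => ?_
    rw [ENNReal.ofReal_mul (by positivity), Real.enorm_eq_ofReal_abs]
  rw [i1, i2, ← ENNReal.ofReal_mul hκ.le] at key
  set D := ∫⁻ p, ‖density lam ν ρ₁ p - density lam ν ρ₂ p‖ₑ ∂(lam.prod ν)
  set E := ENNReal.ofReal (κ * η ^ 2)
  have step : I + ENNReal.ofReal κ * (ENNReal.ofReal (η / 2) * D) ≤ I + 2 * E := by
    calc _ ≤ _ := add_le_add_left (hmin _) _
      _ ≤ _ := key
      _ ≤ 2⁻¹ * (I + E) + 2⁻¹ * (I + E) + E := by gcongr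
      _ = (2⁻¹ + 2⁻¹) * (I + E) + E := by ring
      _ = I + 2 * E := by rw [ENNReal.inv_two_add_inv_two]; ring
  have step2 := (ENNReal.add_le_add_iff_left hI).1 step
  have hpos : 0 < κ * (η / 2) := by positivity
  have hE : 2 * E = ENNReal.ofReal (κ * (η / 2)) * ENNReal.ofReal (4 * η) := by
    rw [← ENNReal.ofReal_mul hpos.le, ← ENNReal.ofReal_ofNat, ← ENNReal.ofReal_mul (by norm_num)]
    congr 1; ring
  rw [← mul_assoc, ← ENNReal.ofReal_mul hκ.le, hE] at step2
  exact (ENNReal.mul_le_mul_iff_right (ENNReal.ofReal_pos.2 hpos).ne' ENNReal.ofReal_ne_top).1 step2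

end StepEnergy

/-! ### `L¹` limits of couplings and passage to the limit. -/

section Limit

variable {X Y : Type*} [MeasurableSpace X] [MeasurableSpace Y] {lam μ : Measure X} {ν : Measure Y}

theorem ofReal_le_ofReal_add_enorm_sub (a b : ℝ) :
    ENNReal.ofReal a ≤ ENNReal.ofReal b + ‖a - b‖ₑ := by
  rw [Real.enorm_eq_ofReal_abs]
  refine le_trans (ENNReal.ofReal_le_ofReal ?_) ENNReal.ofReal_add_le
  linarith [le_abs_self (a - b)]

theorem integrable_density {ρ : ProbabilityMeasure (X × Y)} :
    Integrable (density lam ν ρ) (lam.prod ν) :=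
  Measure.integrable_toReal_rnDeriv

/-- Fatou's lemma applies because the integrand is nonnegative and continuous in the density. -/
theorem entropy_le_liminf {ρ : ℕ → ProbabilityMeasure (X × Y)} {σ : ProbabilityMeasure (X × Y)}
    (ha : ∀ n, (ρ n : Measure (X × Y)) ≪ lam.prod ν) (hσ : (σ : Measure (X × Y)) ≪ lam.prod ν)
    (hlim : ∀ᵐ p ∂(lam.prod ν), Tendsto (fun n => density lam ν (ρ n) p) atTop
      (𝓝 (density lam ν σ p))) :
    entropy lam ν σ ≤ liminf (fun n => entropy lam ν (ρ n)) atTop := by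
  rw [entropy_eq_lintegral hσ]
  simp only [fun n => entropy_eq_lintegral (ha n)]
  refine le_trans (lintegral_mono_ae ?_)
    (lintegral_liminf_le fun n => measurable_ofReal_klFun_density lam ν (ρ n))
  filter_upwards [hlim] with p hp
  have : Tendsto (fun n => ENNReal.ofReal (klFun (density lam ν (ρ n) p))) atTop
      (𝓝 (ENNReal.ofReal (klFun (density lam ν σ p)))) :=
    ENNReal.tendsto_ofReal ((InformationTheory.continuous_klFun.tendsto _).comp hp)
  exact this.liminf_eq.ge

theorem exists_seq_subseq_ae {ρ : ℕ → ProbabilityMeasure (X × Y)} {σ : ProbabilityMeasure (X × Y)}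
    (hlim : Tendsto (fun n => ∫⁻ p, ‖density lam ν (ρ n) p - density lam ν σ p‖ₑ ∂(lam.prod ν))
        atTop (𝓝 0)) :
    ∃ ns : ℕ → ℕ, StrictMono ns ∧ ∀ᵐ p ∂(lam.prod ν),
      Tendsto (fun n => density lam ν (ρ (ns n)) p) atTop (𝓝 (density lam ν σ p)) := by
  refine TendstoInMeasure.exists_seq_tendsto_ae (tendstoInMeasure_of_tendsto_eLpNorm (p := 1)
    one_ne_zero (fun n => (measurable_density _ _ _).aestronglyMeasurable)
    (measurable_density _ _ _).aestronglyMeasurable ?_)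
  simpa only [eLpNorm_one_eq_lintegral_enorm, Pi.sub_apply] using hlim

variable [IsFiniteMeasure lam] [IsFiniteMeasure ν]

/-- Limits in `L¹` of densities of couplings are densities of couplings. -/
theorem exists_coupling_of_tendsto_density {ρ : ℕ → ProbabilityMeasure (X × Y)}
    (hc : ∀ n, ρ n ∈ couplings μ ν) (ha : ∀ n, (ρ n : Measure (X × Y)) ≪ lam.prod ν)
    {r : X × Y → ℝ} (hr : Measurable r) (hr0 : ∀ p, 0 ≤ r p)
    (hlim : Tendsto (fun n => ∫⁻ p, ‖density lam ν (ρ n) p - r p‖ₑ ∂(lam.prod ν)) atTop (𝓝 0)) :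
    ∃ σ ∈ couplings μ ν, (σ : Measure (X × Y)) ≪ lam.prod ν ∧
      density lam ν σ =ᵐ[lam.prod ν] r := by
  set m := (lam.prod ν).withDensity fun p => ENNReal.ofReal (r p) with hm
  have hmeas : ∀ n, Measurable fun p => ‖density lam ν (ρ n) p - r p‖ₑ := fun n =>
    ((measurable_density lam ν (ρ n)).sub hr).enorm
  -- A mass common to all `ρ n` survives in the limit. Applied to the whole space and to cylinders,
  -- this gives total mass `1` and both marginals.
  have hset : ∀ A : Set (X × Y), MeasurableSet A → ∀ c : ℝ≥0∞,
      (∀ n, (ρ n : Measure (X × Y)) A = c) → m A = c := by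
    intro A hA c hcA
    have hn : ∀ n, c = ∫⁻ p in A, ENNReal.ofReal (density lam ν (ρ n) p) ∂(lam.prod ν) := by
      intro n
      rw [← hcA n, ← withDensity_apply _ hA, ← withDensity_density (ha n)]
    have hδ : ∀ n, ∫⁻ p in A, ‖density lam ν (ρ n) p - r p‖ₑ ∂(lam.prod ν) ≤
        ∫⁻ p, ‖density lam ν (ρ n) p - r p‖ₑ ∂(lam.prod ν) := fun n => setLIntegral_le_lintegral _ _
    apply le_antisymm
    · have h1 : ∀ n, m A ≤ c + ∫⁻ p, ‖density lam ν (ρ n) p - r p‖ₑ ∂(lam.prod ν) := by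
        intro n
        refine le_trans ?_ (add_le_add_right (hδ n) _)
        rw [hm, withDensity_apply _ hA, hn n, ← lintegral_add_right _ (hmeas n)]
        refine lintegral_mono fun p => ?_
        rw [← enorm_neg, neg_sub]
        exact ofReal_le_ofReal_add_enorm_sub _ _
      simpa using ge_of_tendsto' (hlim.const_add c) h1
    · have h1 : ∀ n, c ≤ m A + ∫⁻ p, ‖density lam ν (ρ n) p - r p‖ₑ ∂(lam.prod ν) := by
        intro n
        refine le_trans ?_ (add_le_add_right (hδ n) _)
        rw [hm, withDensity_apply _ hA, hn n, ← lintegral_add_right _ (hmeas n)]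
        exact lintegral_mono fun p => ofReal_le_ofReal_add_enorm_sub _ _
      simpa using ge_of_tendsto' (hlim.const_add (m A)) h1
  have hp : IsProbabilityMeasure m := ⟨hset _ MeasurableSet.univ 1 fun n => measure_univ⟩
  refine ⟨⟨m, hp⟩, ⟨?_, ?_⟩, withDensity_absolutelyContinuous _ _, ?_⟩
  · ext B hB
    change m.map Prod.fst B = _
    rw [Measure.map_apply measurable_fst hB]
    refine hset _ (measurable_fst hB) _ fun n => ?_
    rw [← (hc n).1, Measure.map_apply measurable_fst hB]
  · ext B hB
    change m.map Prod.snd B = _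
    rw [Measure.map_apply measurable_snd hB]
    refine hset _ (measurable_snd hB) _ fun n => ?_
    rw [← (hc n).2, Measure.map_apply measurable_snd hB]
  · filter_upwards [Measure.rnDeriv_withDensity (lam.prod ν) hr.ennreal_ofReal] with p hp
    simp only [density, ProbabilityMeasure.coe_mk]
    rw [hp, ENNReal.toReal_ofReal (hr0 p)]

theorem exists_limit_coupling {ρ : ℕ → ProbabilityMeasure (X × Y)}
    (hc : ∀ n, ρ n ∈ couplings μ ν) (ha : ∀ n, (ρ n : Measure (X × Y)) ≪ lam.prod ν)
    {B : ℕ → ℝ≥0∞} (hB : ∑' n, B n ≠ ⊤)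
    (hcau : ∀ N n m : ℕ, N ≤ n → N ≤ m →
      ∫⁻ p, ‖density lam ν (ρ n) p - density lam ν (ρ m) p‖ₑ ∂(lam.prod ν) < B N) :
    ∃ σ ∈ couplings μ ν, (σ : Measure (X × Y)) ≪ lam.prod ν ∧
      Tendsto (fun n => ∫⁻ p, ‖density lam ν (ρ n) p - density lam ν σ p‖ₑ ∂(lam.prod ν))
        atTop (𝓝 0) := by
  obtain ⟨g, hg, hlim⟩ := Lp.cauchy_complete_eLpNorm (μ := lam.prod ν) (p := 1) le_rfl
    (f := fun n => density lam ν (ρ n)) (fun n => memLp_one_iff_integrable.2 integrable_density) hB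
    (fun N n m hn hm => by
      rw [eLpNorm_one_eq_lintegral_enorm]; exact hcau N n m hn hm)
  simp only [eLpNorm_one_eq_lintegral_enorm, Pi.sub_apply] at hlim
  -- The `L¹` limit may be negative or nonmeasurable on a null set. The positive part of a
  -- measurable version repairs this without increasing distances, as `max · 0` is 1-Lipschitz and
  -- fixes densities.
  set g' := hg.1.mk g
  have hg' : Measurable g' := hg.1.stronglyMeasurable_mk.measurable
  have hlim' : Tendsto (fun n => ∫⁻ p, ‖density lam ν (ρ n) p - max (g' p) 0‖ₑ ∂(lam.prod ν))
      atTop (𝓝 0) := by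
    refine tendsto_of_tendsto_of_tendsto_of_le_of_le tendsto_const_nhds hlim
      (fun _ => zero_le) fun n => ?_
    refine lintegral_mono_ae ?_
    filter_upwards [hg.1.ae_eq_mk] with p hp
    rw [hp, enorm_le_iff_norm_le]
    conv_lhs => rw [← max_eq_left (density_nonneg lam ν (ρ n) p)]
    exact abs_max_sub_max_le_abs _ _ _
  obtain ⟨σ, hσ, hσa, hσr⟩ := exists_coupling_of_tendsto_density hc ha
    (r := fun p => max (g' p) 0) (hg'.max measurable_const) (fun p => le_max_right _ _) hlim'
  refine ⟨σ, hσ, hσa, hlim'.congr fun n => lintegral_congr_ae ?_⟩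
  filter_upwards [hσr] with p hp
  rw [hp]

theorem lintegral_potential_le {V : X × Y → ℝ}
    {ρ₁ ρ₂ : ProbabilityMeasure (X × Y)} (hV : Measurable V) {b : ℝ≥0∞}
    (hb : ∀ p, ENNReal.ofReal (V p) ≤ b)
    (h₁ : (ρ₁ : Measure (X × Y)) ≪ lam.prod ν) (h₂ : (ρ₂ : Measure (X × Y)) ≪ lam.prod ν) :
    ∫⁻ p, ENNReal.ofReal (V p) ∂(ρ₁ : Measure (X × Y)) ≤
      ∫⁻ p, ENNReal.ofReal (V p) ∂(ρ₂ : Measure (X × Y)) +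
        b * ∫⁻ p, ‖density lam ν ρ₁ p - density lam ν ρ₂ p‖ₑ ∂(lam.prod ν) := by
  have m1 := measurable_density lam ν ρ₁
  have m2 := measurable_density lam ν ρ₂
  rw [withDensity_density h₁, withDensity_density h₂,
    lintegral_withDensity_eq_lintegral_mul _ m1.ennreal_ofReal hV.ennreal_ofReal,
    lintegral_withDensity_eq_lintegral_mul _ m2.ennreal_ofReal hV.ennreal_ofReal,
    ← lintegral_const_mul _ (by fun_prop), ← lintegral_add_right _ (by fun_prop)]
  refine lintegral_mono fun p => ?_
  simp only [Pi.mul_apply]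
  calc _ ≤ (ENNReal.ofReal (density lam ν ρ₂ p) + ‖density lam ν ρ₁ p - density lam ν ρ₂ p‖ₑ) *
        ENNReal.ofReal (V p) := by gcongr; exact ofReal_le_ofReal_add_enorm_sub _ _
    _ = ENNReal.ofReal (density lam ν ρ₂ p) * ENNReal.ofReal (V p) +
        ENNReal.ofReal (V p) * ‖density lam ν ρ₁ p - density lam ν ρ₂ p‖ₑ := by ring
    _ ≤ _ := by gcongr; exact hb p

end Limit

/-! ### Existence, uniqueness and positivity of the minimizer. -/

section Minimizer

variable {X Y : Type*} [MetricSpace X] [MeasurableSpace X] [StandardBorelSpace X] [Nonempty X]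
  [MeasurableSpace Y] {lam μ : Measure X} {ν : Measure Y} {V : X × Y → ℝ} {κ τ : ℝ}
  {ρbar : ProbabilityMeasure (X × Y)}

variable [IsFiniteMeasure lam] [IsFiniteMeasure ν]

theorem fiberWassersteinSq_le_add {C : ℝ≥0∞} (hC : ∀ x x' : X, edist x x' ^ 2 ≤ C)
    {ρ₁ ρ₂ : ProbabilityMeasure (X × Y)} (hc₁ : ρ₁ ∈ couplings μ ν) (hc₂ : ρ₂ ∈ couplings μ ν)
    (h₁ : (ρ₁ : Measure (X × Y)) ≪ lam.prod ν) (h₂ : (ρ₂ : Measure (X × Y)) ≪ lam.prod ν) :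
    fiberWassersteinSq ν ρ₁ ρbar ≤ fiberWassersteinSq ν ρ₂ ρbar +
        C * ∫⁻ p, ‖density lam ν ρ₁ p - density lam ν ρ₂ p‖ₑ ∂(lam.prod ν) := by
  refine (fiberWassersteinSq_withDensity_le lam hC ρbar hc₁.2 hc₂.2
    (measurable_density lam ν ρ₁).ennreal_ofReal (measurable_density lam ν ρ₂).ennreal_ofReal
    (withDensity_density h₁) (withDensity_density h₂)).trans ?_
  gcongr with p
  exact tsub_le_iff_left.2 (ofReal_le_ofReal_add_enorm_sub _ _)

variable [CompactSpace X] [BorelSpace X]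

theorem exists_isStep (hκ : 0 < κ) (hV : Measurable V) {b C : ℝ≥0∞}
    (hb : ∀ p, ENNReal.ofReal (V p) ≤ b)
    (hb' : b ≠ ⊤) (hC : ∀ x x' : X, edist x x' ^ 2 ≤ C) (hC' : C ≠ ⊤)
    (hfin : ∃ ρ, stepEnergy lam μ ν V κ τ ρbar ρ < ⊤) :
    ∃ ρ, IsStep lam μ ν V κ τ ρbar ρ := by
  set I : ℝ≥0∞ := ⨅ ρ, stepEnergy lam μ ν V κ τ ρbar ρ with hIdef
  have hI : I ≠ ⊤ := by
    obtain ⟨ρ, h⟩ := hfin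
    exact ((iInf_le _ ρ).trans_lt h).ne
  have hmin : ∀ ρ, I ≤ stepEnergy lam μ ν V κ τ ρbar ρ := fun ρ => iInf_le _ ρ
  -- Excess `κ η²` gives distance at most `4 η`; a geometric `η` makes these bounds summable. The
  -- factor `5` used below provides the strict inequality in the Cauchy criterion.
  let η : ℕ → ℝ := fun n => (1 / 2) ^ n
  have hη : ∀ n, 0 < η n := fun n => by positivity
  have hηanti : Antitone η := pow_right_anti₀ (by norm_num) (by norm_num)
  have hex : ∀ n, ∃ ρ, stepEnergy lam μ ν V κ τ ρbar ρ < I + ENNReal.ofReal (κ * η n ^ 2) := by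
    intro n
    refine iInf_lt_iff.1 (ENNReal.lt_add_right hI ?_)
    exact (ENNReal.ofReal_pos.2 (mul_pos hκ (pow_pos (hη n) 2))).ne'
  choose ρ hρ using hex
  have hfinρ : ∀ n, stepEnergy lam μ ν V κ τ ρbar (ρ n) < ⊤ := fun n =>
    (hρ n).trans (ENNReal.add_lt_top.2 ⟨hI.lt_top, ENNReal.ofReal_lt_top⟩)
  have hc : ∀ n, ρ n ∈ couplings μ ν := fun n => mem_couplings_of_stepEnergy_lt_top (hfinρ n)
  have ha : ∀ n, (ρ n : Measure (X × Y)) ≪ lam.prod ν := fun n =>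
    absolutelyContinuous_of_stepEnergy_lt_top hκ (hfinρ n)
  have hle : ∀ N n, N ≤ n →
      stepEnergy lam μ ν V κ τ ρbar (ρ n) ≤ I + ENNReal.ofReal (κ * η N ^ 2) := by
    intro N n h
    refine (hρ n).le.trans (add_le_add_right (ENNReal.ofReal_le_ofReal ?_) _)
    have := hηanti h
    have := (hη n).le
    gcongr
  obtain ⟨σ, hσ, hσa, hlim⟩ := exists_limit_coupling hc ha (B := fun n => ENNReal.ofReal (5 * η n))
    (by
      rw [← ENNReal.ofReal_tsum_of_nonneg (fun n => by positivity)
        (summable_geometric_two.mul_left 5)]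
      exact ENNReal.ofReal_ne_top)
    (fun N n m hn hm => by
      refine (lintegral_density_sub_le hκ hI hmin (hη N) (hle N n hn) (hle N m hm)).trans_lt ?_
      rw [ENNReal.ofReal_lt_ofReal_iff (by have := hη N; positivity)]
      linarith [hη N])
  obtain ⟨ns, hns, hae⟩ := exists_seq_subseq_ae hlim
  have hH := entropy_le_liminf (fun n => ha (ns n)) hσa hae
  suffices h : stepEnergy lam μ ν V κ τ ρbar σ ≤ I from
    ⟨σ, h.trans_lt hI.lt_top, fun ρ' => h.trans (hmin ρ')⟩
  set c := ENNReal.ofReal (1 / (2 * τ)) with hcdef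
  set k := ENNReal.ofReal κ with hkdef
  let δ : ℕ → ℝ≥0∞ := fun n => ∫⁻ p, ‖density lam ν (ρ n) p - density lam ν σ p‖ₑ ∂(lam.prod ν)
  -- The part of the functional other than entropy, which is `L¹`-Lipschitz in the density with
  -- constant `c * C + b`.
  let a : ProbabilityMeasure (X × Y) → ℝ≥0∞ := fun ρ => c * fiberWassersteinSq ν ρ ρbar +
      ∫⁻ p, ENNReal.ofReal (V p) ∂(ρ : Measure (X × Y))
  have hδsymm : ∀ n, ∫⁻ p, ‖density lam ν σ p - density lam ν (ρ n) p‖ₑ ∂(lam.prod ν) = δ n :=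
    fun n => lintegral_congr fun p => by rw [← enorm_neg, neg_sub]
  have haσ : ∀ n, a σ ≤ a (ρ n) + (c * C + b) * δ n := by
    intro n
    have w := fiberWassersteinSq_le_add (ρbar := ρbar) hC hσ (hc n) hσa (ha n)
    have v := lintegral_potential_le hV hb hσa (ha n)
    rw [hδsymm] at w v
    calc a σ ≤ c * (fiberWassersteinSq ν (ρ n) ρbar + C * δ n) +
          (∫⁻ p, ENNReal.ofReal (V p) ∂(ρ n : Measure (X × Y)) + b * δ n) := by
          simp only [a]; gcongr
      _ = a (ρ n) + (c * C + b) * δ n := by simp only [a]; ring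
  have hcb : c * C + b ≠ ⊤ :=
    ENNReal.add_ne_top.2 ⟨ENNReal.mul_ne_top ENNReal.ofReal_ne_top hC', hb'⟩
  have hbound : ∀ n, a σ + k * entropy lam ν (ρ n) ≤
      I + ENNReal.ofReal (κ * η n ^ 2) + (c * C + b) * δ n := by
    intro n
    have h1 := (hρ n).le
    rw [stepEnergy_eq (hc n)] at h1
    calc _ ≤ a (ρ n) + (c * C + b) * δ n + k * entropy lam ν (ρ n) := by gcongr; exact haσ n
      _ = a (ρ n) + k * entropy lam ν (ρ n) + (c * C + b) * δ n := by ring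
      _ ≤ _ := by gcongr
  have hηlim : Tendsto (fun n => I + ENNReal.ofReal (κ * η n ^ 2) + (c * C + b) * δ n) atTop
      (𝓝 I) := by
    have h1 : Tendsto η atTop (𝓝 0) :=
      tendsto_pow_atTop_nhds_zero_of_lt_one (by norm_num) (by norm_num)
    have h2 : Tendsto (fun n => ENNReal.ofReal (κ * η n ^ 2)) atTop (𝓝 0) := by
      simpa using ENNReal.tendsto_ofReal ((h1.pow 2).const_mul κ)
    have h3 : Tendsto (fun n => (c * C + b) * δ n) atTop (𝓝 0) := by
      simpa using ENNReal.Tendsto.const_mul hlim (Or.inr hcb)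
    simpa using (h2.const_add I).add h3
  rw [stepEnergy_eq hσ]
  calc a σ + k * entropy lam ν σ
      ≤ a σ + k * liminf (fun n => entropy lam ν (ρ (ns n))) atTop := by gcongr
    _ = liminf (fun n => a σ + k * entropy lam ν (ρ (ns n))) atTop := by
        rw [← ENNReal.liminf_const_mul_of_ne_top ENNReal.ofReal_ne_top]
        exact (liminf_const_add atTop _ (a σ) (by isBoundedDefault) (by isBoundedDefault)).symm
    _ ≤ liminf (fun n => I + ENNReal.ofReal (κ * η (ns n) ^ 2) + (c * C + b) * δ (ns n)) atTop :=
        liminf_le_liminf (Eventually.of_forall fun n => hbound (ns n))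
    _ = I := (hηlim.comp hns.tendsto_atTop).liminf_eq

/-- Two minimizers are almost minimizers for every `η > 0`, so their densities agree almost
everywhere. -/
theorem IsStep.unique (hκ : 0 < κ) {ρ₁ ρ₂ : ProbabilityMeasure (X × Y)}
    (h₁ : IsStep lam μ ν V κ τ ρbar ρ₁) (h₂ : IsStep lam μ ν V κ τ ρbar ρ₂) : ρ₁ = ρ₂ := by
  have hle : ∀ η : ℝ, 0 < η →
      ∫⁻ p, ‖density lam ν ρ₁ p - density lam ν ρ₂ p‖ₑ ∂(lam.prod ν) ≤ ENNReal.ofReal (4 * η) :=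
    fun η hη => lintegral_density_sub_le hκ h₁.1.ne h₁.2 hη le_self_add
      ((h₂.2 ρ₁).trans le_self_add)
  have h0 : ∫⁻ p, ‖density lam ν ρ₁ p - density lam ν ρ₂ p‖ₑ ∂(lam.prod ν) = 0 := by
    refine le_antisymm (ENNReal.le_of_forall_pos_le_add fun ε hε _ => ?_) (zero_le)
    refine (hle (ε / 4) (by positivity)).trans ?_
    rw [mul_div_cancel₀ _ (by norm_num : (4 : ℝ) ≠ 0)]
    simp
  have m₁ := measurable_density lam ν ρ₁
  have m₂ := measurable_density lam ν ρ₂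
  rw [lintegral_eq_zero_iff (by fun_prop)] at h0
  apply Subtype.ext
  change (ρ₁ : Measure (X × Y)) = (ρ₂ : Measure (X × Y))
  rw [withDensity_density (absolutelyContinuous_of_stepEnergy_lt_top hκ h₁.1),
    withDensity_density (absolutelyContinuous_of_stepEnergy_lt_top hκ h₂.1)]
  refine withDensity_congr_ae ?_
  filter_upwards [h0] with p hp
  rw [sub_eq_zero.1 (enorm_eq_zero.1 hp)]

/-- The density of a minimizer is positive almost everywhere with respect to every competitor
of finite energy. -/
theorem IsStep.density_pos (hκ : 0 < κ) {ρ π : ProbabilityMeasure (X × Y)}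
    (h : IsStep lam μ ν V κ τ ρbar ρ) (hπ : stepEnergy lam μ ν V κ τ ρbar π < ⊤) :
    ∀ᵐ p ∂(π : Measure (X × Y)), 0 < density lam ν ρ p := by
  have ha := absolutelyContinuous_of_stepEnergy_lt_top hκ h.1
  have hc := mem_couplings_of_stepEnergy_lt_top h.1
  have haπ := absolutelyContinuous_of_stepEnergy_lt_top hκ hπ
  have hcπ := mem_couplings_of_stepEnergy_lt_top hπ
  set A := {p | density lam ν ρ p = 0} with hAdef
  have mρ := measurable_density lam ν ρ
  have mπ := measurable_density lam ν π
  have hA : MeasurableSet A := mρ (measurableSet_singleton 0)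
  have key : ∀ n : ℕ, 1 ≤ n → n * (ENNReal.ofReal κ * (π : Measure (X × Y)) A) ≤
      stepEnergy lam μ ν V κ τ ρbar π := by
    intro n hn
    have hn0 : (0 : ℝ) < n := by exact_mod_cast hn
    -- With this weight `-log t = n`, so after division by `t` the gain on `A` is `n κ π(A)`,
    -- bounded by an energy independent of `n`.
    set t : ℝ := Real.exp (-n) with ht
    have ht0 : 0 < t := Real.exp_pos _
    have ht1 : t ≤ 1 := by rw [ht, Real.exp_le_one_iff]; linarith
    have hlog : -Real.log t = n := by rw [ht, Real.log_exp, neg_neg]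
    have hst : ENNReal.ofReal (1 - t) + ENNReal.ofReal t = 1 := by
      rw [← ENNReal.ofReal_add (by linarith) ht0.le]; simp
    have ineq := stepEnergy_mix_add_le (V := V) (κ := κ) (τ := τ) (ρbar := ρbar) hst hc hcπ ha haπ
      (e := A.indicator fun p => t * n * density lam ν π p) (e' := fun _ => 0)
      ((mπ.const_mul _).indicator hA) measurable_const
      (fun p => Set.indicator_nonneg (fun p _ => mul_nonneg (by positivity)
        (density_nonneg lam ν π p)) p) (fun _ => le_rfl) (fun p => by
        rw [ENNReal.toReal_ofReal (by linarith), ENNReal.toReal_ofReal ht0.le, add_zero]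
        by_cases hp : p ∈ A
        · have hp' : density lam ν ρ p = 0 := hp
          rw [Set.indicator_of_mem hp, hp', mul_zero, zero_add, ← hlog,
            klFun_mul_add ht0 (density_nonneg lam ν π p)]
        · rw [Set.indicator_of_notMem hp, add_zero]
          exact InformationTheory.convexOn_klFun.2 (density_nonneg lam ν ρ p)
            (density_nonneg lam ν π p) (by linarith) ht0.le (by ring))
    have hint : ∫⁻ p, ENNReal.ofReal (A.indicator (fun p => t * n * density lam ν π p) p)
        ∂(lam.prod ν) = ENNReal.ofReal t * (n * (π : Measure (X × Y)) A) := by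
      conv_rhs => rw [withDensity_density haπ, withDensity_apply _ hA]
      rw [← ENNReal.ofReal_natCast, ← mul_assoc, ← ENNReal.ofReal_mul ht0.le,
        ← lintegral_const_mul _ mπ.ennreal_ofReal, ← lintegral_indicator hA]
      refine lintegral_congr fun p => ?_
      by_cases hp : p ∈ A
      · rw [Set.indicator_of_mem hp, Set.indicator_of_mem hp, ENNReal.ofReal_mul (by positivity)]
      · simp [hp]
    rw [hint] at ineq
    simp only [ENNReal.ofReal_zero, lintegral_zero, mul_zero, add_zero] at ineq
    set F := stepEnergy lam μ ν V κ τ ρbar ρ with hF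
    set P := (π : Measure (X × Y)) A
    -- Minimality bounds the mixture's energy below by `F = (1 - t) F + t F`; the finite term `(1 -
    -- t) F` then cancels.
    have h2 : ENNReal.ofReal (1 - t) * F + (ENNReal.ofReal t * F +
        ENNReal.ofReal κ * (ENNReal.ofReal t * (n * P))) ≤
        ENNReal.ofReal (1 - t) * F + ENNReal.ofReal t * stepEnergy lam μ ν V κ τ ρbar π := by
      refine le_trans (le_of_eq ?_) ((add_le_add_left (h.2 _) _).trans ineq)
      rw [← add_assoc, ← add_mul, hst, one_mul]
    have h3 := (ENNReal.add_le_add_iff_left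
      (ENNReal.mul_ne_top ENNReal.ofReal_ne_top h.1.ne)).1 h2
    have h4 : ENNReal.ofReal t * (n * (ENNReal.ofReal κ * P)) ≤
        ENNReal.ofReal t * stepEnergy lam μ ν V κ τ ρbar π := by
      refine le_trans (le_of_eq ?_) ((le_add_self).trans h3)
      ring
    exact (ENNReal.mul_le_mul_iff_right (ENNReal.ofReal_pos.2 ht0).ne' ENNReal.ofReal_ne_top).1 h4
  have hP : (π : Measure (X × Y)) A = 0 := by
    by_contra hne
    obtain ⟨n, hn⟩ := ENNReal.exists_nat_mul_gt
      (mul_ne_zero (ENNReal.ofReal_pos.2 hκ).ne' hne) hπ.ne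
    refine absurd hn (not_lt.2 (key n (Nat.one_le_iff_ne_zero.2 ?_)))
    rintro rfl
    simp at hn
  have : ∀ᵐ p ∂(π : Measure (X × Y)), p ∉ A := measure_eq_zero_iff_ae_notMem.1 hP
  filter_upwards [this] with p hp
  exact (density_nonneg lam ν ρ p).lt_of_ne' hp

end Minimizer

/-! ### The product measure as a competitor of finite energy. -/

section Product

variable {X Y : Type*} [MeasurableSpace X] [MeasurableSpace Y] {lam : Measure X}
  [IsFiniteMeasure lam]

/-- The density of `μ ⊗ ν` is that of `μ`, with values almost everywhere in `[0, C]`, where `klFun`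
is bounded; and `lam ⊗ ν` is finite. -/
theorem entropy_prod_lt_top (μ : ProbabilityMeasure X) (ν : ProbabilityMeasure Y)
    (hμ : (μ : Measure X) ≪ lam)
    (hbdd : ∃ C : ℝ≥0, ∀ᵐ x ∂lam, (μ : Measure X).rnDeriv lam x ≤ C) :
    entropy lam (ν : Measure Y) (μ.prod ν) < ⊤ := by
  obtain ⟨C, hC⟩ := hbdd
  have hm := Measure.measurable_rnDeriv (μ : Measure X) lam
  have hprod : ((μ.prod ν : ProbabilityMeasure (X × Y)) : Measure (X × Y)) =
      (lam.prod (ν : Measure Y)).withDensity fun p => (μ : Measure X).rnDeriv lam p.1 := by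
    rw [← prod_withDensity_left hm, Measure.withDensity_rnDeriv_eq _ _ hμ]
    rfl
  have hac : ((μ.prod ν : ProbabilityMeasure (X × Y)) : Measure (X × Y)) ≪
      lam.prod (ν : Measure Y) := by
    rw [hprod]; exact withDensity_absolutelyContinuous _ _
  obtain ⟨b, hb⟩ := (isCompact_Icc (a := (0 : ℝ)) (b := C)).exists_bound_of_continuousOn
    InformationTheory.continuous_klFun.continuousOn
  rw [entropy_eq_lintegral hac]
  have hle : ∀ᵐ p ∂(lam.prod (ν : Measure Y)),
      ENNReal.ofReal (klFun (density lam (ν : Measure Y) (μ.prod ν) p)) ≤ ENNReal.ofReal b := by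
    have hC' : ∀ᵐ p ∂(lam.prod (ν : Measure Y)), (μ : Measure X).rnDeriv lam p.1 ≤ C :=
      Measure.quasiMeasurePreserving_fst.ae hC
    filter_upwards [hC', Measure.rnDeriv_withDensity (lam.prod (ν : Measure Y))
      (hm.comp measurable_fst)] with p h1 h2
    refine ENNReal.ofReal_le_ofReal ((le_abs_self _).trans (hb _ ⟨density_nonneg _ _ _ _, ?_⟩))
    rw [density, hprod]
    refine ENNReal.toReal_le_coe_of_le_coe ?_
    exact (le_of_eq h2).trans h1
  calc _ ≤ ∫⁻ _, ENNReal.ofReal b ∂(lam.prod (ν : Measure Y)) := lintegral_mono_ae hle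
    _ < ⊤ := by
      rw [lintegral_const]
      exact ENNReal.mul_lt_top ENNReal.ofReal_lt_top (measure_lt_top _ _)

theorem prod_mem_couplings (μ : ProbabilityMeasure X) (ν : ProbabilityMeasure Y) :
    μ.prod ν ∈ couplings (μ : Measure X) (ν : Measure Y) := by
  constructor <;> simp

theorem stepEnergy_prod_lt_top {X : Type*} [MetricSpace X] [MeasurableSpace X]
    [StandardBorelSpace X] [Nonempty X] {lam : Measure X} [IsFiniteMeasure lam]
    (μ : ProbabilityMeasure X) (ν : ProbabilityMeasure Y) (hμ : (μ : Measure X) ≪ lam)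
    (hbdd : ∃ C : ℝ≥0, ∀ᵐ x ∂lam, (μ : Measure X).rnDeriv lam x ≤ C) {V : X × Y → ℝ} {κ τ : ℝ}
    {b C : ℝ≥0∞} (hb : ∀ p, ENNReal.ofReal (V p) ≤ b) (hb' : b ≠ ⊤)
    (hC : ∀ x x' : X, edist x x' ^ 2 ≤ C) (hC' : C ≠ ⊤) (ρbar : ProbabilityMeasure (X × Y)) :
    stepEnergy lam (μ : Measure X) (ν : Measure Y) V κ τ ρbar (μ.prod ν) < ⊤ := by
  rw [stepEnergy_eq (prod_mem_couplings μ ν)]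
  have hV : ∫⁻ p, ENNReal.ofReal (V p) ∂((μ.prod ν : ProbabilityMeasure (X × Y)) : Measure _) ≤ b :=
    (lintegral_mono hb).trans (by simp)
  refine ENNReal.add_lt_top.2 ⟨ENNReal.add_lt_top.2 ⟨?_, hV.trans_lt hb'.lt_top⟩, ?_⟩
  · exact ENNReal.mul_lt_top ENNReal.ofReal_lt_top
      ((fiberWassersteinSq_le hC _ _).trans_lt hC'.lt_top)
  · exact ENNReal.mul_lt_top ENNReal.ofReal_lt_top (entropy_prod_lt_top μ ν hμ hbdd)

end Product

/-! ### Iteration of the step. -/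

section Scheme

variable {X Y : Type*} [MetricSpace X] [MeasurableSpace X] [StandardBorelSpace X] [Nonempty X]
  [MeasurableSpace Y] {lam μ : Measure X} {ν : Measure Y} {V : X × Y → ℝ} {κ τ : ℝ}

theorem existsUnique_isScheme
    (hstep : ∀ ρbar ∈ couplings μ ν, ∃! ρ, IsStep lam μ ν V κ τ ρbar ρ)
    {ρ₀ : ProbabilityMeasure (X × Y)} (hρ₀ : ρ₀ ∈ couplings μ ν) :
    ∃! ρ : ℕ → ProbabilityMeasure (X × Y), IsScheme lam μ ν V κ τ ρ₀ ρ := by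
  -- A minimizer of finite energy is again a coupling, so the step is a self-map of `couplings μ ν`
  -- and can be iterated.
  have hnext : ∀ ρbar : couplings μ ν, ∃ ρ : couplings μ ν,
      IsStep lam μ ν V κ τ ρbar.1 ρ.1 := fun ρbar => by
    obtain ⟨ρ, hρ, -⟩ := hstep ρbar.1 ρbar.2
    exact ⟨⟨ρ, mem_couplings_of_stepEnergy_lt_top hρ.1⟩, hρ⟩
  choose next hn using hnext
  let seq : ℕ → couplings μ ν := fun n => next^[n] ⟨ρ₀, hρ₀⟩
  have hseq : ∀ n, IsStep lam μ ν V κ τ (seq n).1 (seq (n + 1)).1 := fun n => by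
    simp only [seq, Function.iterate_succ_apply']
    exact hn _
  refine ⟨fun n => (seq n).1, ⟨rfl, hseq⟩, fun ρ hρ => funext fun n => ?_⟩
  induction n with
  | zero => exact hρ.1
  | succ n ih =>
    have h := hρ.2 n
    rw [ih] at h
    exact (hstep _ (seq n).2).unique h (hseq n)

end Scheme

instance {d : ℕ} (X : TopologicalSpace.NonemptyCompacts (EuclideanSpace ℝ (Fin d))) :
    IsFiniteMeasure (lebesgue X) := by
  have h := comap_subtype_coe_apply X.isCompact.measurableSet volume Set.univ
  rw [Set.image_univ, Subtype.range_coe] at h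
  exact ⟨(le_of_eq h).trans_lt X.isCompact.measure_lt_top⟩

end FiberedJKO

theorem mainTheorem7 (d d' : ℕ)
    (X : TopologicalSpace.NonemptyCompacts (EuclideanSpace ℝ (Fin d)))
    (Y : TopologicalSpace.Compacts (EuclideanSpace ℝ (Fin d')))
    (μ : ProbabilityMeasure X) (ν : ProbabilityMeasure Y)
    (hμ : (μ : Measure X) ≪ FiberedJKO.lebesgue X)
    (hμ_bdd : ∃ C : ℝ≥0, ∀ᵐ x ∂(FiberedJKO.lebesgue X),
      (μ : Measure X).rnDeriv (FiberedJKO.lebesgue X) x ≤ C)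
    (V : X × Y → ℝ) (hV : Continuous V) (hV0 : ∀ p, 0 ≤ V p)
    (κ τ : ℝ) (hκ : 0 < κ) (hτ : 0 < τ) :
    (∀ ρbar ∈ FiberedJKO.couplings (μ : Measure X) (ν : Measure Y),
      (∃! ρ : ProbabilityMeasure (X × Y),
        FiberedJKO.IsStep (FiberedJKO.lebesgue X) (μ : Measure X) (ν : Measure Y) V κ τ ρbar ρ) ∧
      ∀ ρ : ProbabilityMeasure (X × Y),
        FiberedJKO.IsStep (FiberedJKO.lebesgue X) (μ : Measure X) (ν : Measure Y) V κ τ ρbar ρ →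
        ρ ∈ FiberedJKO.couplings (μ : Measure X) (ν : Measure Y) ∧
        (ρ : Measure (X × Y)) ≪ (FiberedJKO.lebesgue X).prod (ν : Measure Y) ∧
        ∀ᵐ p ∂((μ : Measure X).prod (ν : Measure Y)),
          0 < FiberedJKO.density (FiberedJKO.lebesgue X) (ν : Measure Y) ρ p) ∧
    (∀ ρ₀ ∈ FiberedJKO.couplings (μ : Measure X) (ν : Measure Y),
      (∃! ρ : ℕ → ProbabilityMeasure (X × Y),
        FiberedJKO.IsScheme (FiberedJKO.lebesgue X) (μ : Measure X) (ν : Measure Y) V κ τ ρ₀ ρ) ∧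
      ∀ ρ : ℕ → ProbabilityMeasure (X × Y),
        FiberedJKO.IsScheme (FiberedJKO.lebesgue X) (μ : Measure X) (ν : Measure Y) V κ τ ρ₀ ρ →
        ∀ n : ℕ, 1 ≤ n →
          (ρ n : Measure (X × Y)) ≪ (FiberedJKO.lebesgue X).prod (ν : Measure Y) ∧
          ∀ᵐ p ∂((μ : Measure X).prod (ν : Measure Y)),
            0 < FiberedJKO.density (FiberedJKO.lebesgue X) (ν : Measure Y) (ρ n) p) := by
  obtain ⟨b, hb⟩ := isCompact_univ.exists_bound_of_continuousOn hV.continuousOn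
  have hVb : ∀ p, ENNReal.ofReal (V p) ≤ ENNReal.ofReal b := fun p =>
    ENNReal.ofReal_le_ofReal ((le_abs_self _).trans (hb p (Set.mem_univ p)))
  have hC : ∀ x x' : X, edist x x' ^ 2 ≤ Metric.ediam (Set.univ : Set X) ^ 2 := fun x x' => by
    gcongr
    exact Metric.edist_le_ediam_of_mem (Set.mem_univ x) (Set.mem_univ x')
  have hC' : Metric.ediam (Set.univ : Set X) ^ 2 ≠ ⊤ :=
    ENNReal.pow_ne_top isCompact_univ.isBounded.ediam_ne_top
  -- The product `μ ⊗ ν` plays two roles: it makes the infimum finite, and as competitor in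
  -- `IsStep.density_pos` it gives positivity `μ ⊗ ν`-almost everywhere.
  have hfin : ∀ ρbar, FiberedJKO.stepEnergy (FiberedJKO.lebesgue X) (μ : Measure X)
      (ν : Measure Y) V κ τ ρbar (μ.prod ν) < ⊤ :=
    FiberedJKO.stepEnergy_prod_lt_top μ ν hμ hμ_bdd hVb ENNReal.ofReal_ne_top hC hC'
  have hstep : ∀ ρbar : ProbabilityMeasure (X × Y), ∃! ρ, FiberedJKO.IsStep
      (FiberedJKO.lebesgue X) (μ : Measure X) (ν : Measure Y) V κ τ ρbar ρ := fun ρbar => by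
    obtain ⟨ρ, hρ⟩ := FiberedJKO.exists_isStep hκ hV.measurable hVb ENNReal.ofReal_ne_top hC hC'
      ⟨_, hfin ρbar⟩
    exact ⟨ρ, hρ, fun ρ' hρ' => hρ'.unique hκ hρ⟩
  have hprop : ∀ ρbar ρ : ProbabilityMeasure (X × Y), FiberedJKO.IsStep
      (FiberedJKO.lebesgue X) (μ : Measure X) (ν : Measure Y) V κ τ ρbar ρ →
      ρ ∈ FiberedJKO.couplings (μ : Measure X) (ν : Measure Y) ∧
        (ρ : Measure (X × Y)) ≪ (FiberedJKO.lebesgue X).prod (ν : Measure Y) ∧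
        ∀ᵐ p ∂((μ : Measure X).prod (ν : Measure Y)),
          0 < FiberedJKO.density (FiberedJKO.lebesgue X) (ν : Measure Y) ρ p := fun ρbar ρ hρ =>
    ⟨FiberedJKO.mem_couplings_of_stepEnergy_lt_top hρ.1,
      FiberedJKO.absolutelyContinuous_of_stepEnergy_lt_top hκ hρ.1, hρ.density_pos hκ (hfin ρbar)⟩
  refine ⟨fun ρbar _ => ⟨hstep ρbar, hprop ρbar⟩, fun ρ₀ hρ₀ =>
    ⟨FiberedJKO.existsUnique_isScheme (fun ρbar _ => hstep ρbar) hρ₀, fun ρ hρ n hn => ?_⟩⟩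
  obtain ⟨m, rfl⟩ : ∃ m, n = m + 1 := ⟨n - 1, by omega⟩
  exact (hprop _ _ (hρ.2 m)).2
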